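/- **Setting.** A principal and an agent interact for $T\ge 2$ rounds. The agent's efforts are $a\in[0,E]$, with cost $c:[0,E]\to\mathbb R$ that is nondecreasing, satisfies $c(0)=0$, and is $\lambda$-strongly convex, $\lambda>0$ (i.e. $c(a)-\tfrac{\lambda}{2}a^2$ is convex). An effort $a$ produces a random output $y\in[0,1]$ with law $P_a$ and mean $a$. There are $K\ge1$ candidate linear contracts $\beta^{(1)},\dots,\beta^{(K)}\in[0,1]$; for each of them a myopic best response $a(\beta)\in\arg\max_{a\in[0,E]}(\beta a-c(a))$ exists (it is then unique). Put $u(\beta)=(1-\beta)a(\beta)$, $\Delta_i=\max_k u(\beta^{(k)})-u(\beta^{(i)})$, and, for a discount factor $\gamma\in(0,1)$, $T_\gamma=\sum_{t=1}^T\gamma^t$. The principal announces a mechanism, which chooses the contract $\beta_t$ of round $t$ from the past contracts and outputs. The agent, who knows the mechanism, uses a (possibly randomized) strategy which chooses $a_t\in[0,E]$ from $\beta_t$ and all past contracts, outputs and efforts; then $y_t\sim P_{a_t}$ is observed. The agent's strategy maximizes $\mathbb E\big[\sum_{t=1}^T\gamma^t(\beta_t y_t-c(a_t))\big]$ among all strategies.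 The strategic regret is $\max_i T\,u(\beta^{(i)})-\mathbb E\big[\sum_{t=1}^T(1-\beta_t)y_t\big]$. **Mechanism (delayed elimination with delay $D$ and perturbation $\delta$).** Start with the active set $A$ of all $K$ contracts. Repeat until $T$ rounds have been played: with $t$ the number of rounds played so far, post every contract of $A$ once, in a fixed order; then for $\beta\in A$ let $S_\beta=\{1\le\tau<t-D:\beta_\tau=\beta\}$, $\hat u(\beta)=\frac1{|S_\beta|}\sum_{\tau\in S_\beta}(1-\beta)y_\tau$, $\mathrm{UCB}(\beta),\mathrm{LCB}(\beta)=\hat u(\beta)\pm\big(\sqrt{2\log T/|S_\beta|}+\delta\big)$ (equal to $\pm\infty$ if $S_\beta=\emptyset$), and remove from $A$ every $\beta$ with $\mathrm{UCB}(\beta)<\max_{\beta'\in A}\mathrm{LCB}(\beta')$. **Theorem.** There is a universal constant $C>0$ such that, in every such setting with $T\,T_\gamma\ge 2\lambda$, if the principal runs delayed elimination with $$D=\frac{\ln(T^2T_\gamma/\lambda)}{\ln(1/\gamma)},\qquad \delta=\frac1T,$$ then against every optimal strategy of the agent the strategic regret is at most $$C\left(\sum_{i:\,\Delta_i>0}\frac{\log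 T}{\Delta_i}+\frac{\log(T\,T_\gamma/\lambda)\,\log K}{\log(1/\gamma)}\right).$$ -/

import Mathlib

open MeasureTheory ProbabilityTheory Set
open scoped unitInterval

noncomputable section

namespace NonMyopic

/-! ### The stage game -/

/-- `a` is a myopic best response in the effort set `[0, E]` to the linear contract `b`, for an
agent with cost function `c` (effort `a` produces expected output `a`). -/
def IsBestResponse (E : ℝ) (c : ℝ → ℝ) (b a : ℝ) : Prop :=
  a ∈ Icc (0 : ℝ) E ∧ ∀ a' ∈ Icc (0 : ℝ) E, b * a' - c a' ≤ b * a - c a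

/-- The truthful (myopic best-response) effort `a(b)`; it is unique for a strongly convex cost. -/
def bestResponse (E : ℝ) (c : ℝ → ℝ) (b : ℝ) : ℝ :=
  Classical.epsilon (IsBestResponse E c b)

/-- `u(b) = (1 - b) a(b)`, the principal's expected one-round utility under truthful response. -/
def truthfulUtility (E : ℝ) (c : ℝ → ℝ) (b : ℝ) : ℝ :=
  (1 - b) * bestResponse E c b

/-- `max_{b ∈ C} u(b)` for the candidate contracts `C = {β 0, …, β (K - 1)}`. -/
def bestUtility {K : ℕ} (E : ℝ) (c : ℝ → ℝ) (β : Fin K → ℝ) : ℝ :=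
  ⨆ i, truthfulUtility E c (β i)

/-- The gap `Δ_i = max_{b ∈ C} u(b) - u(β i)`. -/
def gap {K : ℕ} (E : ℝ) (c : ℝ → ℝ) (β : Fin K → ℝ) (i : Fin K) : ℝ :=
  bestUtility E c β - truthfulUtility E c (β i)

/-- `T_γ = ∑_{t=1}^T γ^t`. -/
def discountedHorizon (γ : ℝ) (T : ℕ) : ℝ :=
  ∑ t ∈ Finset.Icc 1 T, γ ^ t

/-! ### The repeated interaction -/

/-- What the principal sees of a round: the posted contract (its index) and the output. -/
abbrev Obs (K : ℕ) : Type := Fin K × I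

/-- The full record of a round: posted contract (its index), effort in `[0, E]`, output. -/
abbrev Round (K : ℕ) (E : ℝ) : Type := (Fin K × Icc (0 : ℝ) E) × I

/-- The part of a history that the principal observes. -/
def publicPart {K : ℕ} {E : ℝ} {t : ℕ} (h : Fin t → Round K E) : Fin t → Obs K :=
  fun j => ((h j).1.1, (h j).2)

lemma measurable_publicPart {K : ℕ} {E : ℝ} {t : ℕ} :
    Measurable (publicPart : (Fin t → Round K E) → Fin t → Obs K) := by
  unfold publicPart
  fun_prop

/-- A mechanism of the principal: after `t` rounds, the observed contracts and outputs determine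
a distribution over the candidate contracts. -/
structure Mechanism (K : ℕ) where
  kernel : (t : ℕ) → Kernel (Fin t → Obs K) (Fin K)
  markov : ∀ t, IsMarkovKernel (kernel t)

/-- A strategy of the agent: after `t` rounds, the full history (contracts, efforts, outputs) and
the contract just posted determine a distribution over efforts in `[0, E]`. -/
structure Strategy (K : ℕ) (E : ℝ) where
  kernel : (t : ℕ) → Kernel ((Fin t → Round K E) × Fin K) (Icc (0 : ℝ) E)
  markov : ∀ t, IsMarkovKernel (kernel t)

/-- The conditional law of a round given the history of the `t` rounds before it: a contract is
posted, the agent chooses an effort `a`, and the output is drawn from `P a`. -/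
def roundKernel {K : ℕ} {E : ℝ} (P : Kernel (Icc (0 : ℝ) E) I) (M : Mechanism K)
    (S : Strategy K E) (t : ℕ) : Kernel (Fin t → Round K E) (Round K E) :=
  (((M.kernel t).comap publicPart measurable_publicPart) ⊗ₖ (S.kernel t)) ⊗ₖ
    (P.comap (fun p : (Fin t → Round K E) × (Fin K × Icc (0 : ℝ) E) => p.2.2)
      (measurable_snd.comp measurable_snd))

/-- The law of the first `t` rounds. -/
def historyLaw {K : ℕ} {E : ℝ} (P : Kernel (Icc (0 : ℝ) E) I) (M : Mechanism K)
    (S : Strategy K E) : (t : ℕ) → Measure (Fin t → Round K E)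
  | 0 => Measure.dirac Fin.elim0
  | t + 1 => (historyLaw P M S t ⊗ₘ roundKernel P M S t).map
      (fun p => Fin.snoc (α := fun _ => Round K E) p.1 p.2)

/-- The agent's expected discounted utility
`𝔼 [∑_{t=1}^T γ^t (β_t y_t - c(a_t))]`. The coordinate `j` is round `j + 1`. -/
def agentUtility {K : ℕ} {E : ℝ} (β : Fin K → ℝ) (c : ℝ → ℝ) (P : Kernel (Icc (0 : ℝ) E) I)
    (γ : ℝ) (T : ℕ) (M : Mechanism K) (S : Strategy K E) : ℝ :=
  ∫ h, ∑ j : Fin T, γ ^ ((j : ℕ) + 1) * (β (h j).1.1 * ((h j).2 : ℝ) - c (h j).1.2)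
    ∂(historyLaw P M S T)

/-- `S` maximizes the agent's expected discounted utility against the announced mechanism `M`. -/
def IsOptimalStrategy {K : ℕ} {E : ℝ} (β : Fin K → ℝ) (c : ℝ → ℝ) (P : Kernel (Icc (0 : ℝ) E) I)
    (γ : ℝ) (T : ℕ) (M : Mechanism K) (S : Strategy K E) : Prop :=
  ∀ S' : Strategy K E, agentUtility β c P γ T M S' ≤ agentUtility β c P γ T M S

/-- The strategic regret `max_{b ∈ C} T u(b) - 𝔼 [∑_{t=1}^T (1 - β_t) y_t]` of the mechanism `M`
when the agent plays `S`. -/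
def strategicRegret {K : ℕ} {E : ℝ} (β : Fin K → ℝ) (c : ℝ → ℝ) (P : Kernel (Icc (0 : ℝ) E) I)
    (T : ℕ) (M : Mechanism K) (S : Strategy K E) : ℝ :=
  T * bestUtility E c β -
    ∫ h, ∑ j : Fin T, (1 - β (h j).1.1) * ((h j).2 : ℝ) ∂(historyLaw P M S T)

/-! ### Delayed elimination

Throughout, `s` is the number of rounds played before the current pass over the active arms. -/

/-- The rounds `1 ≤ τ < s - D` in which contract `i` was posted (coordinate `j` is round
`τ = j + 1`). -/
def delayedSample {K t : ℕ} (D : ℝ) (h : Fin t → Obs K) (s : ℕ) (i : Fin K) : Finset (Fin t) :=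
  Finset.univ.filter (fun j => (((j : ℕ) + 1 : ℕ) : ℝ) < (s : ℝ) - D ∧ (h j).1 = i)

/-- The empirical mean of the principal's utility `(1 - β i) y` over the delayed sample. -/
def empiricalUtility {K t : ℕ} (β : Fin K → ℝ) (D : ℝ) (h : Fin t → Obs K) (s : ℕ)
    (i : Fin K) : ℝ :=
  (∑ j ∈ delayedSample D h s i, (1 - β i) * ((h j).2 : ℝ)) / (delayedSample D h s i).card

/-- The half-width `√(2 log T / |S|) + δ` of the confidence interval. -/
def confidenceRadius {K t : ℕ} (T : ℕ) (D δ : ℝ) (h : Fin t → Obs K) (s : ℕ) (i : Fin K) : ℝ :=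
  √(2 * Real.log T / (delayedSample D h s i).card) + δ

/-- `UCB(i) < max_{k ∈ A} LCB(k)`, where `UCB = +∞` and `LCB = -∞` for an arm whose delayed
sample is empty. -/
def IsEliminated {K t : ℕ} (β : Fin K → ℝ) (T : ℕ) (D δ : ℝ) (h : Fin t → Obs K) (s : ℕ)
    (A : Finset (Fin K)) (i : Fin K) : Prop :=
  ∃ k ∈ A, (delayedSample D h s i).Nonempty ∧ (delayedSample D h s k).Nonempty ∧
    empiricalUtility β D h s i + confidenceRadius T D δ h s i <
      empiricalUtility β D h s k - confidenceRadius T D δ h s k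

open Classical in
/-- The state of the algorithm after `t` rounds: the number `s` of rounds played before the
current pass, and the set `A` of active arms. A pass pulls every arm of `A` once; at its end the
indices are updated and arms are removed. -/
def eliminationState {K : ℕ} (β : Fin K → ℝ) (T : ℕ) (D δ : ℝ) :
    (t : ℕ) → (Fin t → Obs K) → ℕ × Finset (Fin K)
  | 0, _ => (0, Finset.univ)
  | t + 1, h =>
    let st := eliminationState β T D δ t (fun j => h j.castSucc)
    if t + 1 = st.1 + st.2.card then
      (t + 1, st.2.filter (fun i => ¬ IsEliminated β T D δ h st.1 st.2 i))
    else st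

/-- The arm pulled in round `t + 1`: the next one, in the order of the indices, in the current
pass over the active arms. -/
def nextArm {K : ℕ} [NeZero K] (β : Fin K → ℝ) (T : ℕ) (D δ : ℝ) (t : ℕ)
    (h : Fin t → Obs K) : Fin K :=
  ((eliminationState β T D δ t h).2.sort (· ≤ ·)).getD (t - (eliminationState β T D δ t h).1) 0

lemma measurable_card_delayedSample {K t : ℕ} (D : ℝ) (s : ℕ) (i : Fin K) :
    Measurable (fun h : Fin t → Obs K => (delayedSample D h s i).card) := by
  unfold delayedSample
  simp only [Finset.card_filter]
  refine Finset.measurable_sum _ fun j _ => ?_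
  refine Measurable.ite ?_ measurable_const measurable_const
  refine (MeasurableSet.const _).inter ?_
  exact (measurable_fst.comp (measurable_pi_apply j)) (MeasurableSet.singleton i)

lemma measurable_empiricalUtility {K t : ℕ} (β : Fin K → ℝ) (D : ℝ) (s : ℕ) (i : Fin K) :
    Measurable (fun h : Fin t → Obs K => empiricalUtility β D h s i) := by
  unfold empiricalUtility
  refine Measurable.div ?_ (measurable_from_top.comp (measurable_card_delayedSample D s i))
  unfold delayedSample
  simp only [Finset.sum_filter]
  refine Finset.measurable_sum _ fun j _ => ?_
  refine Measurable.ite ?_ (by fun_prop) measurable_const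
  refine (MeasurableSet.const _).inter ?_
  exact (measurable_fst.comp (measurable_pi_apply j)) (MeasurableSet.singleton i)

lemma measurable_confidenceRadius {K t : ℕ} (T : ℕ) (D δ : ℝ) (s : ℕ) (i : Fin K) :
    Measurable (fun h : Fin t → Obs K => confidenceRadius T D δ h s i) := by
  unfold confidenceRadius
  have := (measurable_from_top (f := fun n : ℕ => (n : ℝ))).comp
    (measurable_card_delayedSample (t := t) D s i)
  simp only [Function.comp_def] at this
  fun_prop

lemma measurableSet_isEliminated {K t : ℕ} (β : Fin K → ℝ) (T : ℕ) (D δ : ℝ) (s : ℕ)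
    (A : Finset (Fin K)) (i : Fin K) :
    MeasurableSet {h : Fin t → Obs K | IsEliminated β T D δ h s A i} := by
  have hne : ∀ k : Fin K, MeasurableSet {h : Fin t → Obs K | (delayedSample D h s k).Nonempty} := by
    intro k
    simp only [← Finset.card_pos]
    exact measurableSet_lt measurable_const (measurable_card_delayedSample D s k)
  unfold IsEliminated
  simp only [ofPred_exists, ofPred_and]
  refine MeasurableSet.iUnion fun k => (MeasurableSet.const _).inter
    ((hne i).inter ((hne k).inter (measurableSet_lt ?_ ?_)))
  · exact (measurable_empiricalUtility β D s i).add (measurable_confidenceRadius T D δ s i)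
  · exact (measurable_empiricalUtility β D s k).sub (measurable_confidenceRadius T D δ s k)

lemma measurableSet_eliminationState {K : ℕ} (β : Fin K → ℝ) (T : ℕ) (D δ : ℝ) (t : ℕ)
    (v : ℕ × Finset (Fin K)) :
    MeasurableSet {h : Fin t → Obs K | eliminationState β T D δ t h = v} := by
  classical
  induction t generalizing v with
  | zero =>
    by_cases hv : ((0, Finset.univ) : ℕ × Finset (Fin K)) = v
    · simp [eliminationState, hv]
    · simp [eliminationState, hv]
  | succ t ih =>
    have hinit : Measurable (fun (h : Fin (t + 1) → Obs K) (j : Fin t) => h j.castSucc) := by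
      fun_prop
    have key : {h : Fin (t + 1) → Obs K | eliminationState β T D δ (t + 1) h = v} =
        ⋃ w : ℕ × Finset (Fin K),
          {h | eliminationState β T D δ t (fun j => h j.castSucc) = w} ∩
          {h | (if t + 1 = w.1 + w.2.card then
            (t + 1, w.2.filter (fun i => ¬ IsEliminated β T D δ h w.1 w.2 i)) else w) = v} := by
      ext h
      simp only [mem_ofPred_eq, mem_iUnion, mem_inter_iff, eliminationState]
      constructor
      · intro hh
        exact ⟨_, rfl, by convert hh⟩
      · rintro ⟨w, rfl, hh⟩
        convert hh
    rw [key]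
    refine MeasurableSet.iUnion fun w => (hinit (ih w)).inter ?_
    by_cases hw : t + 1 = w.1 + w.2.card
    · simp only [if_pos hw, Prod.ext_iff, Finset.ext_iff, Finset.mem_filter, ofPred_and,
        ofPred_forall]
      refine (MeasurableSet.const _).inter (MeasurableSet.iInter fun i => ?_)
      by_cases h1 : i ∈ w.2 <;> by_cases h2 : i ∈ v.2 <;>
        simp only [h1, h2, true_and, false_and, iff_true, iff_false, not_not,
          ofPred_true, ofPred_false, MeasurableSet.univ, MeasurableSet.empty]
      · exact (measurableSet_isEliminated β T D δ w.1 w.2 i).compl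
      · exact measurableSet_isEliminated β T D δ w.1 w.2 i
    · simp only [if_neg hw]
      exact MeasurableSet.const _

lemma measurable_nextArm {K : ℕ} [NeZero K] (β : Fin K → ℝ) (T : ℕ) (D δ : ℝ) (t : ℕ) :
    Measurable (nextArm β T D δ t) := by
  refine measurable_to_countable' fun i => ?_
  have : nextArm β T D δ t ⁻¹' {i} =
      ⋃ w ∈ {w : ℕ × Finset (Fin K) | (w.2.sort (· ≤ ·)).getD (t - w.1) 0 = i},
        {h | eliminationState β T D δ t h = w} := by
    ext h
    simp [nextArm]
  rw [this]
  exact MeasurableSet.biUnion (to_countable _) fun w _ => measurableSet_eliminationState β T D δ t w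

/-- The delayed elimination mechanism over the contracts `β`, with horizon `T`, delay `D` and
perturbation `δ`. -/
def delayedElimination {K : ℕ} [NeZero K] (β : Fin K → ℝ) (T : ℕ) (D δ : ℝ) : Mechanism K where
  kernel t := Kernel.deterministic (nextArm β T D δ t) (measurable_nextArm β T D δ t)
  markov _ := inferInstance

/-- The delay `D = ln (T² T_γ / lam) / ln (1 / γ)`. -/
def delay (γ lam : ℝ) (T : ℕ) : ℝ :=
  Real.log ((T : ℝ) ^ 2 * discountedHorizon γ T / lam) / Real.log (1 / γ)

end NonMyopic

end

/-! Incentives. Delayed elimination reads an output only more than `D` rounds after it occurs, so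
what the agent does now affects contracts only in rounds whose discounted value is small. Compare an
optimal strategy with the one that, on an event `B` of the history, plays myopic best responses from
some round on (`deviate`). Until the influence of that round is felt, the law of the contracts is
the same under both, so the deviation loses nothing; afterwards it loses at most 1 per round, since
best-response values lie in `[0, 1]`. As `B` is arbitrary, the utility forgone in a round is,
conditionally on almost every history, at most a normalized discounted tail (`ae_loss_le`), and `D`
is chosen to make this tail at most `γ λ / T²` (`influence_le`). Strong convexity turns the utility
loss into `|mean effort - a(β)| ≤ √(2γ) / T` (`abs_meanEffort_sub_le`). Over `T` rounds this costs
the principal at most `√(2γ)`.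

Concentration. The outputs of each arm therefore behave like samples with conditional mean within
`O(1/T)` of `a(β)`. A product of Hoeffding factors has expectation at most 1 against any such
strategy, so all confidence intervals hold except with probability `O(1/T)`
(`measure_not_isConcentrated_le`); the failure event adds `O(1)` to the regret.

Elimination. On concentrated observations everything is deterministic. The best arm stays active,
and an arm that survives a test has a delayed sample of size `O(log T / Δ²)`. The pulls missing from
the sample fall in a window of about `D` rounds, which the active arms share evenly, so each has
about `D / |A|` of them (`card_mul_pullCount_sub_le`). When the suboptimal arms are ordered by their
last pull, the numbers of arms still active give a harmonic sum, whence a factor `log K` and not `K`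
(`sum_inv_card_filter_le_log`, `sum_gap_le`).

Arithmetic. The delay contains `log T` besides `log (T T_γ / λ)`. The surplus is absorbed by the gap
term when `γ ≤ 1/2`, and by the bound `min 1 (2/λ)` on the gaps otherwise (`min_mul_log_le`,
`delay_cost_le`). -/

namespace NonMyopic

/-! ### Delayed elimination along a sequence of observations -/

/-- The first `t` terms of a sequence of observations. -/
def initialSegment {K : ℕ} (o : ℕ → Obs K) (t : ℕ) : Fin t → Obs K := fun j => o j

/-- The number of times arm `i` is pulled in the first `t` rounds. -/
def pullCount {K : ℕ} (o : ℕ → Obs K) (i : Fin K) (t : ℕ) : ℕ :=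
  ((Finset.range t).filter fun j => (o j).1 = i).card

/-- The number of rounds played before the pass that is under way after `t` rounds. -/
noncomputable def passStart {K : ℕ} (β : Fin K → ℝ) (T : ℕ) (D δ : ℝ) (o : ℕ → Obs K)
    (t : ℕ) : ℕ :=
  (eliminationState β T D δ t (initialSegment o t)).1

/-- The set of active arms after `t` rounds. -/
noncomputable def activeArms {K : ℕ} (β : Fin K → ℝ) (T : ℕ) (D δ : ℝ) (o : ℕ → Obs K)
    (t : ℕ) : Finset (Fin K) :=
  (eliminationState β T D δ t (initialSegment o t)).2

/-- The contracts in the sequence are those posted by delayed elimination, for `T` rounds. -/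
def FollowsElimination {K : ℕ} [NeZero K] (β : Fin K → ℝ) (T : ℕ) (D δ : ℝ)
    (o : ℕ → Obs K) : Prop :=
  ∀ t < T, (o t).1 = nextArm β T D δ t (initialSegment o t)

/-! ### Counting pulls -/

section PullCount

variable {K : ℕ} (o : ℕ → Obs K)

lemma pullCount_zero (i : Fin K) : pullCount o i 0 = 0 := by simp [pullCount]

lemma pullCount_succ (i : Fin K) (t : ℕ) :
    pullCount o i (t + 1) = pullCount o i t + if (o t).1 = i then 1 else 0 := by
  unfold pullCount
  rw [Finset.range_add_one, Finset.filter_insert]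
  split_ifs <;> simp

lemma pullCount_mono (i : Fin K) : Monotone (pullCount o i) :=
  monotone_nat_of_le_succ fun t => by rw [pullCount_succ]; omega

lemma pullCount_le (i : Fin K) (t : ℕ) : pullCount o i t ≤ t :=
  (Finset.card_filter_le _ _).trans (Finset.card_range t).le

lemma sum_pullCount (t : ℕ) : ∑ i, pullCount o i t = t := by
  induction t with
  | zero => simp [pullCount_zero]
  | succ t ih => simp [pullCount_succ, Finset.sum_add_distrib, ih]

lemma sum_pullCount_mul (f : Fin K → ℝ) (t : ℕ) :
    ∑ i, (pullCount o i t : ℝ) * f i = ∑ j ∈ Finset.range t, f (o j).1 := by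
  induction t with
  | zero => simp [pullCount_zero]
  | succ t ih =>
    simp [pullCount_succ, Finset.sum_range_succ, ← ih, add_mul, Finset.sum_add_distrib]

lemma exists_last_pull (i : Fin K) (t : ℕ) (h : pullCount o i t ≠ 0) :
    ∃ e < t, (o e).1 = i ∧ pullCount o i t = pullCount o i (e + 1) := by
  induction t with
  | zero => simp [pullCount_zero] at h
  | succ t ih =>
    by_cases ht : (o t).1 = i
    · exact ⟨t, by omega, ht, rfl⟩
    · have h1 : pullCount o i (t + 1) = pullCount o i t := by simp [pullCount_succ, ht]
      rw [h1] at h ⊢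
      obtain ⟨e, he, h2, h3⟩ := ih h
      exact ⟨e, by omega, h2, h3⟩

end PullCount

/-- The delayed sample before the pass that starts after `s` rounds consists of the pulls in the
first `⌈s - D - 1⌉₊` rounds. -/
lemma sum_delayedSample {K : ℕ} (o : ℕ → Obs K) {D : ℝ} (hD : 0 ≤ D) {s t : ℕ} (hst : s ≤ t)
    (i : Fin K) (f : Obs K → ℝ) :
    ∑ j ∈ delayedSample D (initialSegment o t) s i, f (initialSegment o t j) =
      ∑ j ∈ Finset.range ⌈(s : ℝ) - D - 1⌉₊ with (o j).1 = i, f (o j) := by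
  unfold delayedSample
  have hw : ⌈(s : ℝ) - D - 1⌉₊ ≤ s := Nat.ceil_le.2 (by linarith)
  refine Finset.sum_bij (fun j _ => (j : ℕ)) ?_ ?_ ?_ ?_
  · intro j hj
    simp only [Finset.mem_filter, Finset.mem_univ, true_and, Finset.mem_range] at hj ⊢
    refine ⟨Nat.lt_ceil.2 ?_, hj.2⟩
    have := hj.1
    push_cast at this
    linarith
  · intro j _ k _ h
    exact Fin.ext h
  · intro j hj
    simp only [Finset.mem_filter, Finset.mem_range] at hj
    refine ⟨⟨j, by omega⟩, ?_, rfl⟩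
    have := Nat.lt_ceil.1 hj.1
    simp only [Finset.mem_filter, Finset.mem_univ, true_and]
    refine ⟨?_, hj.2⟩
    push_cast
    linarith
  · intro j _
    rfl

lemma card_delayedSample {K : ℕ} (o : ℕ → Obs K) {D : ℝ} (hD : 0 ≤ D) {s t : ℕ} (hst : s ≤ t)
    (i : Fin K) :
    (delayedSample D (initialSegment o t) s i).card = pullCount o i ⌈(s : ℝ) - D - 1⌉₊ := by
  have := sum_delayedSample o hD hst i (fun _ => 1)
  unfold pullCount
  simp only [Finset.sum_const, nsmul_eq_mul, mul_one] at this
  exact_mod_cast this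

/-! ### Passes, active arms and the balance of their pull counts -/

section States

variable {K : ℕ} (β : Fin K → ℝ) (T : ℕ) (D δ : ℝ) (o : ℕ → Obs K)

lemma passStart_zero : passStart β T D δ o 0 = 0 := rfl

lemma activeArms_zero : activeArms β T D δ o 0 = Finset.univ := rfl

lemma passStart_succ_of_eq {t : ℕ}
    (h : t + 1 = passStart β T D δ o t + (activeArms β T D δ o t).card) :
    passStart β T D δ o (t + 1) = t + 1 := by
  unfold passStart activeArms at h
  change t + 1 = (eliminationState β T D δ t (fun j => initialSegment o (t + 1) j.castSucc)).1 +
    (eliminationState β T D δ t (fun j => initialSegment o (t + 1) j.castSucc)).2.card at h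
  simp only [passStart, eliminationState]
  rw [if_pos h]

lemma mem_activeArms_succ_of_eq {t : ℕ}
    (h : t + 1 = passStart β T D δ o t + (activeArms β T D δ o t).card) (i : Fin K) :
    i ∈ activeArms β T D δ o (t + 1) ↔ i ∈ activeArms β T D δ o t ∧
      ¬ IsEliminated β T D δ (initialSegment o (t + 1)) (passStart β T D δ o t)
        (activeArms β T D δ o t) i := by
  have h' := h
  unfold passStart activeArms at h
  change t + 1 = (eliminationState β T D δ t (fun j => initialSegment o (t + 1) j.castSucc)).1 +
    (eliminationState β T D δ t (fun j => initialSegment o (t + 1) j.castSucc)).2.card at h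
  conv_lhs => simp only [activeArms, eliminationState]
  rw [if_pos h]
  exact @Finset.mem_filter _ _ (_) _ _

lemma eliminationState_succ_of_ne {t : ℕ}
    (h : t + 1 ≠ passStart β T D δ o t + (activeArms β T D δ o t).card) :
    eliminationState β T D δ (t + 1) (initialSegment o (t + 1)) =
      eliminationState β T D δ t (initialSegment o t) := by
  unfold passStart activeArms at h
  change t + 1 ≠ (eliminationState β T D δ t (fun j => initialSegment o (t + 1) j.castSucc)).1 +
    (eliminationState β T D δ t (fun j => initialSegment o (t + 1) j.castSucc)).2.card at h
  simp only [eliminationState]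
  rw [if_neg h]
  rfl

lemma passStart_succ_of_ne {t : ℕ}
    (h : t + 1 ≠ passStart β T D δ o t + (activeArms β T D δ o t).card) :
    passStart β T D δ o (t + 1) = passStart β T D δ o t := by
  unfold passStart
  rw [eliminationState_succ_of_ne β T D δ o h]

lemma activeArms_succ_of_ne {t : ℕ}
    (h : t + 1 ≠ passStart β T D δ o t + (activeArms β T D δ o t).card) :
    activeArms β T D δ o (t + 1) = activeArms β T D δ o t := by
  unfold activeArms
  rw [eliminationState_succ_of_ne β T D δ o h]

lemma activeArms_antitone : Antitone (activeArms β T D δ o) := by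
  refine antitone_nat_of_succ_le fun t => ?_
  by_cases h : t + 1 = passStart β T D δ o t + (activeArms β T D δ o t).card
  · intro i hi
    exact ((mem_activeArms_succ_of_eq β T D δ o h i).1 hi).1
  · exact (activeArms_succ_of_ne β T D δ o h).le

variable {δ}

/-- The arm with the largest lower confidence bound survives, because its own upper bound is no
smaller. Hence the active set never becomes empty. -/
lemma exists_not_isEliminated {t : ℕ} (hδ : 0 ≤ δ) (h : Fin t → Obs K) (s : ℕ)
    {A : Finset (Fin K)} (hA : A.Nonempty) : ∃ i ∈ A, ¬ IsEliminated β T D δ h s A i := by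
  by_cases hB : (A.filter fun k => (delayedSample D h s k).Nonempty).Nonempty
  · obtain ⟨i, hi, hmax⟩ := Finset.exists_max_image _
      (fun k => empiricalUtility β D h s k - confidenceRadius T D δ h s k) hB
    refine ⟨i, (Finset.mem_filter.1 hi).1, ?_⟩
    rintro ⟨k, hk, -, hk', hlt⟩
    have h1 := hmax k (Finset.mem_filter.2 ⟨hk, hk'⟩)
    have h2 : 0 ≤ confidenceRadius T D δ h s i := by unfold confidenceRadius; positivity
    linarith
  · obtain ⟨i, hi⟩ := hA
    refine ⟨i, hi, ?_⟩
    rintro ⟨k, hk, -, hk', -⟩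
    exact hB ⟨k, Finset.mem_filter.2 ⟨hk, hk'⟩⟩

lemma passStart_le (t : ℕ) : passStart β T D δ o t ≤ t := by
  induction t with
  | zero => rfl
  | succ t ih =>
    by_cases h : t + 1 = passStart β T D δ o t + (activeArms β T D δ o t).card
    · exact (passStart_succ_of_eq β T D δ o h).le
    · rw [passStart_succ_of_ne β T D δ o h]
      omega

lemma activeArms_nonempty [NeZero K] (hδ : 0 ≤ δ) (t : ℕ) : (activeArms β T D δ o t).Nonempty := by
  induction t with
  | zero => exact ⟨0, by simp [activeArms_zero]⟩
  | succ t ih =>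
    by_cases h : t + 1 = passStart β T D δ o t + (activeArms β T D δ o t).card
    · obtain ⟨i, hi, hi'⟩ := exists_not_isEliminated β T D hδ (initialSegment o (t + 1))
        (passStart β T D δ o t) ih
      exact ⟨i, (mem_activeArms_succ_of_eq β T D δ o h i).2 ⟨hi, hi'⟩⟩
    · rwa [activeArms_succ_of_ne β T D δ o h]

/-- The pass under way is never complete, so the position looked up by `nextArm` is always valid and
the default arm 0 of `getD` plays no role. -/
lemma lt_passStart_add [NeZero K] (hδ : 0 ≤ δ) (t : ℕ) :
    t < passStart β T D δ o t + (activeArms β T D δ o t).card := by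
  have hpos := fun t => Finset.card_pos.2 (activeArms_nonempty β T D o hδ t)
  induction t with
  | zero => have := hpos 0; omega
  | succ t ih =>
    by_cases h : t + 1 = passStart β T D δ o t + (activeArms β T D δ o t).card
    · rw [passStart_succ_of_eq β T D δ o h]
      have := hpos (t + 1)
      omega
    · rw [passStart_succ_of_ne β T D δ o h, activeArms_succ_of_ne β T D δ o h]
      omega

/-- Being active during a pass other than the first means having survived the test at the end of the
preceding pass; this locates that test. -/
lemma exists_previous_pass (t : ℕ) (h : passStart β T D δ o t ≠ 0) :
    ∃ u, passStart β T D δ o t = u + 1 ∧ u + 1 ≤ t ∧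
      u + 1 = passStart β T D δ o u + (activeArms β T D δ o u).card ∧
      activeArms β T D δ o t = activeArms β T D δ o (u + 1) := by
  induction t with
  | zero => exact absurd rfl h
  | succ t ih =>
    by_cases h1 : t + 1 = passStart β T D δ o t + (activeArms β T D δ o t).card
    · exact ⟨t, passStart_succ_of_eq β T D δ o h1, le_rfl, h1, rfl⟩
    · rw [passStart_succ_of_ne β T D δ o h1] at h ⊢
      rw [activeArms_succ_of_ne β T D δ o h1]
      obtain ⟨u, h2, h3, h4⟩ := ih h
      exact ⟨u, h2, by omega, h4⟩

lemma passStart_eq_zero_of_lt {t : ℕ} (ht : t < K) :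
    passStart β T D δ o t = 0 ∧ activeArms β T D δ o t = Finset.univ := by
  induction t with
  | zero => exact ⟨rfl, rfl⟩
  | succ t ih =>
    obtain ⟨h1, h2⟩ := ih (by omega)
    have h : t + 1 ≠ passStart β T D δ o t + (activeArms β T D δ o t).card := by
      rw [h1, h2, Finset.card_univ, Fintype.card_fin]
      omega
    rw [passStart_succ_of_ne β T D δ o h, activeArms_succ_of_ne β T D δ o h]
    exact ⟨h1, h2⟩

/-- The position of an arm in the order in which the active arms are pulled. -/
noncomputable def armPosition (A : Finset (Fin K)) (i : Fin K) : ℕ := (A.sort (· ≤ ·)).idxOf i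

lemma armPosition_lt {A : Finset (Fin K)} {i : Fin K} (hi : i ∈ A) : armPosition A i < A.card := by
  have := List.idxOf_lt_length_of_mem ((Finset.mem_sort (s := A) (· ≤ ·)).2 hi)
  rwa [Finset.length_sort] at this

lemma getD_sort_eq_iff [NeZero K] {A : Finset (Fin K)} {i : Fin K} (hi : i ∈ A) {k : ℕ}
    (hk : k < A.card) : (A.sort (· ≤ ·)).getD k 0 = i ↔ armPosition A i = k := by
  have hk' : k < (A.sort (· ≤ ·)).length := by rwa [Finset.length_sort]
  rw [List.getD_eq_getElem _ _ hk']
  constructor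
  · rintro rfl
    exact (Finset.sort_nodup A (· ≤ ·)).idxOf_getElem k hk'
  · rintro rfl
    exact List.getElem_idxOf _

variable [NeZero K]

lemma nextArm_eq_iff (hδ : 0 ≤ δ) {t : ℕ} {i : Fin K} (hi : i ∈ activeArms β T D δ o t) :
    nextArm β T D δ t (initialSegment o t) = i ↔
      armPosition (activeArms β T D δ o t) i = t - passStart β T D δ o t := by
  have h1 := lt_passStart_add β T D o hδ t
  have h2 := passStart_le β T D (δ := δ) o t
  have hk : t - passStart β T D δ o t < (activeArms β T D δ o t).card := by omega
  exact getD_sort_eq_iff hi hk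

lemma nextArm_mem_activeArms (hδ : 0 ≤ δ) (t : ℕ) :
    nextArm β T D δ t (initialSegment o t) ∈ activeArms β T D δ o t := by
  have h1 := lt_passStart_add β T D o hδ t
  have h2 := passStart_le β T D (δ := δ) o t
  have hk : t - passStart β T D δ o t <
      ((activeArms β T D δ o t).sort (· ≤ ·)).length := by
    rw [Finset.length_sort]; omega
  unfold nextArm
  change ((activeArms β T D δ o t).sort (· ≤ ·)).getD (t - passStart β T D δ o t) 0 ∈ _
  rw [List.getD_eq_getElem _ _ hk]
  exact (Finset.mem_sort _).1 (List.getElem_mem hk)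

variable {o}

/-- During a pass, exactly the active arms before the current position have been pulled, and at
the start of a pass all active arms have been pulled equally often. -/
lemma pullCount_of_mem_activeArms (hδ : 0 ≤ δ) (ho : FollowsElimination β T D δ o) {t : ℕ}
    (ht : t ≤ T) :
    (∀ i ∈ activeArms β T D δ o t, pullCount o i t = pullCount o i (passStart β T D δ o t) +
      if armPosition (activeArms β T D δ o t) i < t - passStart β T D δ o t then 1 else 0) ∧
    (∀ i ∈ activeArms β T D δ o t, ∀ k ∈ activeArms β T D δ o t,
      pullCount o i (passStart β T D δ o t) = pullCount o k (passStart β T D δ o t)) := by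
  induction t with
  | zero => simp [passStart_zero, pullCount_zero]
  | succ t ih =>
    obtain ⟨ih1, ih2⟩ := ih (by omega)
    have hle := passStart_le β T D (δ := δ) o t
    have hpull : ∀ i ∈ activeArms β T D δ o t, pullCount o i (t + 1) =
        pullCount o i (passStart β T D δ o t) +
        if armPosition (activeArms β T D δ o t) i < t + 1 - passStart β T D δ o t
        then 1 else 0 := by
      intro i hi
      rw [pullCount_succ, ih1 i hi, ho t (by omega)]
      simp only [nextArm_eq_iff β T D o hδ hi]
      split_ifs <;> omega
    by_cases h : t + 1 = passStart β T D δ o t + (activeArms β T D δ o t).card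
    · have hsub := activeArms_antitone β T D δ o (show t ≤ t + 1 by omega)
      rw [passStart_succ_of_eq β T D δ o h]
      refine ⟨fun i hi => by simp, fun i hi k hk => ?_⟩
      rw [hpull i (hsub hi), hpull k (hsub hk), ih2 i (hsub hi) k (hsub hk),
        if_pos (by have := armPosition_lt (hsub hi); omega),
        if_pos (by have := armPosition_lt (hsub hk); omega)]
    · rw [passStart_succ_of_ne β T D δ o h, activeArms_succ_of_ne β T D δ o h]
      exact ⟨hpull, ih2⟩

lemma pullCount_le_add_one (hδ : 0 ≤ δ) (ho : FollowsElimination β T D δ o) {t : ℕ}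
    (ht : t ≤ T) {i k : Fin K} (hi : i ∈ activeArms β T D δ o t)
    (hk : k ∈ activeArms β T D δ o t) : pullCount o i t ≤ pullCount o k t + 1 := by
  obtain ⟨h1, h2⟩ := pullCount_of_mem_activeArms β T D hδ ho ht
  rw [h1 i hi, h1 k hk, h2 i hi k hk]
  split_ifs <;> omega

lemma pullCount_succ_passStart (hδ : 0 ≤ δ) (ho : FollowsElimination β T D δ o) {t : ℕ}
    (ht : t < T) :
    pullCount o (o t).1 (t + 1) = pullCount o (o t).1 (passStart β T D δ o t) + 1 := by
  obtain ⟨h1, -⟩ := pullCount_of_mem_activeArms β T D hδ ho ht.le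
  have hmem := nextArm_mem_activeArms β T D o hδ t
  rw [← ho t ht] at hmem
  have hpos := (nextArm_eq_iff β T D o hδ hmem).1 (ho t ht).symm
  rw [pullCount_succ, h1 _ hmem, if_pos rfl, if_neg (by omega)]

lemma pullCount_pass_end (hδ : 0 ≤ δ) (ho : FollowsElimination β T D δ o) {u : ℕ} (hu : u < T)
    (h : u + 1 = passStart β T D δ o u + (activeArms β T D δ o u).card) {i : Fin K}
    (hi : i ∈ activeArms β T D δ o u) :
    pullCount o i (u + 1) = pullCount o i (passStart β T D δ o u) + 1 := by
  obtain ⟨h1, -⟩ := pullCount_of_mem_activeArms β T D hδ ho hu.le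
  rw [pullCount_succ, h1 i hi, ho u hu]
  simp only [nextArm_eq_iff β T D o hδ hi]
  have := armPosition_lt hi
  split_ifs <;> omega

/-- Over the delay window before a pass, an active arm is pulled about as often as each of the
other active arms. -/
lemma card_mul_pullCount_sub_le (hδ : 0 ≤ δ) (ho : FollowsElimination β T D δ o) {u w : ℕ}
    (hu : u ≤ T) (hw : w ≤ passStart β T D δ o u) {i : Fin K}
    (hi : i ∈ activeArms β T D δ o u) :
    ((activeArms β T D δ o u).card : ℝ) *
        ((pullCount o i (passStart β T D δ o u) : ℝ) - pullCount o i w - 1) ≤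
      (passStart β T D δ o u : ℝ) - w := by
  have hs := passStart_le β T D (δ := δ) o u
  have hsub := activeArms_antitone β T D δ o (hw.trans hs)
  obtain ⟨-, h2⟩ := pullCount_of_mem_activeArms β T D hδ ho hu
  set s := passStart β T D δ o u
  calc ((activeArms β T D δ o u).card : ℝ) * ((pullCount o i s : ℝ) - pullCount o i w - 1)
      = ∑ _k ∈ activeArms β T D δ o u, ((pullCount o i s : ℝ) - pullCount o i w - 1) := by
        rw [Finset.sum_const, nsmul_eq_mul]
    _ ≤ ∑ k ∈ activeArms β T D δ o u, ((pullCount o k s : ℝ) - pullCount o k w) := by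
        -- Arms active now were active at time `w` too. Their counts agree at the start `s` of the
        -- pass and differ by at most one at `w`, which accounts for the `- 1`.
        refine Finset.sum_le_sum fun k hk => ?_
        have h3 : pullCount o k w ≤ pullCount o i w + 1 :=
          pullCount_le_add_one β T D hδ ho (by omega) (hsub hk) (hsub hi)
        rw [h2 i hi k hk]
        have : (pullCount o k w : ℝ) ≤ pullCount o i w + 1 := by exact_mod_cast h3
        linarith
    _ ≤ ∑ k, ((pullCount o k s : ℝ) - pullCount o k w) := by
        refine Finset.sum_le_univ_sum_of_nonneg fun k => ?_
        have : (pullCount o k w : ℝ) ≤ pullCount o k s := by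
          exact_mod_cast pullCount_mono o k hw
        linarith
    _ = (s : ℝ) - w := by
        rw [Finset.sum_sub_distrib]
        have h4 := sum_pullCount o s
        have h5 := sum_pullCount o w
        have h6 : (∑ k, (pullCount o k s : ℝ)) = s := by exact_mod_cast h4
        have h7 : (∑ k, (pullCount o k w : ℝ)) = w := by exact_mod_cast h5
        rw [h6, h7]

end States

/-- At all times up to `T`, the average output of every arm `i` is as close to `x i` as the
confidence interval requires. -/
def IsConcentrated {K : ℕ} (T : ℕ) (δ : ℝ) (x : Fin K → ℝ) (o : ℕ → Obs K) : Prop :=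
  ∀ t ≤ T, ∀ i, pullCount o i t ≠ 0 →
    |∑ j ∈ Finset.range t with (o j).1 = i, (((o j).2 : ℝ) - x i)| ≤
      pullCount o i t * (√(2 * Real.log T / pullCount o i t) + δ)

/-- Sorted by `f`, the counts run through `1, …, m`, so the sum is `1/2 + … + 1/(m+1)`. Removing the
minimum of `f` removes the largest count and leaves the other counts unchanged. -/
lemma sum_inv_card_filter_le_log {ι : Type*} [DecidableEq ι] (f : ι → ℕ) (s : Finset ι)
    (hf : Set.InjOn f s) :
    ∑ i ∈ s, 1 / (((s.filter fun k => f i ≤ f k).card : ℝ) + 1) ≤ Real.log ((s.card : ℝ) + 1) := by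
  induction s using Finset.induction_on_min_value f with
  | empty => simp
  | insert a s ha hmin ih =>
    have ih' := ih (hf.mono (by simp))
    rw [Finset.sum_insert ha, Finset.card_insert_of_notMem ha]
    have h1 : (insert a s).filter (fun k => f a ≤ f k) = insert a s := by
      refine Finset.filter_true_of_mem fun k hk => ?_
      rcases Finset.mem_insert.1 hk with rfl | hk
      · exact le_rfl
      · exact hmin k hk
    have h2 : ∀ i ∈ s, (insert a s).filter (fun k => f i ≤ f k) = s.filter fun k => f i ≤ f k := by
      intro i hi
      rw [Finset.filter_insert, if_neg]
      intro hle
      have : f a = f i := le_antisymm (hmin i hi) hle |>.symm ▸ rfl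
      have := hf (by simp) (by simp [hi]) this
      exact ha (this ▸ hi)
    rw [h1, Finset.card_insert_of_notMem ha, Finset.sum_congr rfl fun i hi => by rw [h2 i hi]]
    have h3 : (0 : ℝ) < (s.card : ℝ) + 1 := by positivity
    -- One term of the comparison of the harmonic sum with the logarithm, from `log x ≤ x - 1`.
    have h4 : 1 / ((s.card : ℝ) + 1 + 1) ≤
        Real.log ((s.card : ℝ) + 1 + 1) - Real.log ((s.card : ℝ) + 1) := by
      have h5 := Real.log_le_sub_one_of_pos
        (show 0 < ((s.card : ℝ) + 1) / ((s.card : ℝ) + 1 + 1) by positivity)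
      rw [Real.log_div (by positivity) (by positivity)] at h5
      have h6 : ((s.card : ℝ) + 1) / ((s.card : ℝ) + 1 + 1) - 1 = - (1 / ((s.card : ℝ) + 1 + 1)) := by
        field_simp
        ring
      linarith
    push_cast
    linarith

/-! ### Regret along concentrated observations -/

section Elimination

variable {K : ℕ} {β : Fin K → ℝ} {T : ℕ} {D δ : ℝ} {o : ℕ → Obs K} {x : Fin K → ℝ}

/-- Passing from outputs to utilities multiplies the deviation by `1 - β i`, which is at most 1, so
the same radius suffices. -/
lemma abs_empiricalUtility_sub_le (hβ : ∀ i, β i ∈ Icc (0 : ℝ) 1) (hD : 0 ≤ D)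
    (hc : IsConcentrated T δ x o) {s t : ℕ} (hst : s ≤ t) (ht : t ≤ T) {i : Fin K}
    (hne : (delayedSample D (initialSegment o t) s i).Nonempty) :
    |empiricalUtility β D (initialSegment o t) s i - (1 - β i) * x i| ≤
      confidenceRadius T D δ (initialSegment o t) s i := by
  have hcard := Finset.card_pos.2 hne
  have hw : ⌈(s : ℝ) - D - 1⌉₊ ≤ s := Nat.ceil_le.2 (by linarith)
  unfold empiricalUtility confidenceRadius
  rw [card_delayedSample o hD hst] at hcard ⊢
  rw [sum_delayedSample o hD hst i fun r => (1 - β i) * (r.2 : ℝ)]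
  have h := hc _ (by omega) i hcard.ne'
  set w := ⌈(s : ℝ) - D - 1⌉₊
  have hn : (0 : ℝ) < pullCount o i w := by exact_mod_cast hcard
  have h1 : (∑ j ∈ Finset.range w with (o j).1 = i, (1 - β i) * ((o j).2 : ℝ)) /
      pullCount o i w - (1 - β i) * x i =
      (1 - β i) * ((∑ j ∈ Finset.range w with (o j).1 = i, (((o j).2 : ℝ) - x i)) /
        pullCount o i w) := by
    rw [Finset.sum_sub_distrib, Finset.sum_const, ← Finset.mul_sum, nsmul_eq_mul]
    change _ = (1 - β i) * ((_ - (pullCount o i w : ℝ) * x i) / _)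
    field_simp
  rw [h1, abs_mul, abs_div, abs_of_pos hn, abs_of_nonneg (by linarith [(hβ i).2])]
  have h2 : |∑ j ∈ Finset.range w with (o j).1 = i, (((o j).2 : ℝ) - x i)| / pullCount o i w ≤
      √(2 * Real.log T / pullCount o i w) + δ := by
    rw [div_le_iff₀ hn, mul_comm]
    exact h
  have h3 : 0 ≤ |∑ j ∈ Finset.range w with (o j).1 = i, (((o j).2 : ℝ) - x i)| /
      pullCount o i w := by positivity
  nlinarith [(hβ i).1, (hβ i).2]

lemma lt_of_isEliminated (hβ : ∀ i, β i ∈ Icc (0 : ℝ) 1) (hD : 0 ≤ D)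
    (hc : IsConcentrated T δ x o) {s t : ℕ} (hst : s ≤ t) (ht : t ≤ T) {A : Finset (Fin K)}
    {i : Fin K} (h : IsEliminated β T D δ (initialSegment o t) s A i) :
    ∃ k ∈ A, (1 - β i) * x i < (1 - β k) * x k := by
  obtain ⟨k, hk, h1, h2, h3⟩ := h
  have h4 := abs_le.1 (abs_empiricalUtility_sub_le hβ hD hc hst ht h1)
  have h5 := abs_le.1 (abs_empiricalUtility_sub_le hβ hD hc hst ht h2)
  exact ⟨k, hk, by linarith [h4.1, h5.2]⟩

/-- With valid confidence intervals, an elimination certifies an arm that is strictly better; the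
best arm has none. -/
lemma optimal_mem_activeArms (hβ : ∀ i, β i ∈ Icc (0 : ℝ) 1) (hD : 0 ≤ D)
    (hc : IsConcentrated T δ x o) {b : Fin K} (hb : ∀ i, (1 - β i) * x i ≤ (1 - β b) * x b)
    {t : ℕ} (ht : t ≤ T) : b ∈ activeArms β T D δ o t := by
  induction t with
  | zero => simp [activeArms_zero]
  | succ t ih =>
    by_cases h : t + 1 = passStart β T D δ o t + (activeArms β T D δ o t).card
    · refine (mem_activeArms_succ_of_eq β T D δ o h b).2 ⟨ih (by omega), fun hel => ?_⟩
      obtain ⟨k, -, hk⟩ := lt_of_isEliminated hβ hD hc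
        ((passStart_le β T D o t).trans (Nat.le_succ t)) ht hel
      exact absurd (hb k) (not_le.2 hk)
    · rw [activeArms_succ_of_ne β T D δ o h]
      exact ih (by omega)

variable [NeZero K]

/-- An arm which survives a pass has a delayed sample of size `O(log T / Δ²)`. -/
lemma pullCount_le_of_not_isEliminated (hβ : ∀ i, β i ∈ Icc (0 : ℝ) 1) (hT : 2 ≤ T) (hD : 0 ≤ D)
    (hδ : 0 ≤ δ) (hδT : δ ≤ 1 / T) (ho : FollowsElimination β T D δ o)
    (hc : IsConcentrated T δ x o) {u t : ℕ} (hut : u ≤ t) (ht : t ≤ T) {i b : Fin K}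
    (hi : i ∈ activeArms β T D δ o u) (hbA : b ∈ activeArms β T D δ o u)
    (hgap : 0 < (1 - β b) * x b - (1 - β i) * x i)
    (hel : ¬ IsEliminated β T D δ (initialSegment o t) (passStart β T D δ o u)
      (activeArms β T D δ o u) i) :
    (pullCount o i ⌈(passStart β T D δ o u : ℝ) - D - 1⌉₊ : ℝ) ≤
      1 + 128 * Real.log T / ((1 - β b) * x b - (1 - β i) * x i) ^ 2 := by
  have hsu := passStart_le β T D (δ := δ) o u
  set s := passStart β T D δ o u
  have hst : s ≤ t := hsu.trans hut
  have hw : ⌈(s : ℝ) - D - 1⌉₊ ≤ s := Nat.ceil_le.2 (by linarith)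
  have hcard := card_delayedSample o hD hst (D := D)
  set w := ⌈(s : ℝ) - D - 1⌉₊ with hwdef
  set g := (1 - β b) * x b - (1 - β i) * x i
  have hlog : 0 < Real.log T := Real.log_pos (by exact_mod_cast hT)
  -- The best arm may be one pull behind, so both samples are only known to have `pullCount o i w -
  -- 1` elements, and this has to be positive.
  by_cases hn2 : pullCount o i w ≤ 1
  · have : (pullCount o i w : ℝ) ≤ 1 := by exact_mod_cast hn2
    have h0 : 0 ≤ 128 * Real.log T / g ^ 2 := by positivity
    linarith
  have hsub := activeArms_antitone β T D δ o (hw.trans hsu)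
  have hnb : pullCount o i w ≤ pullCount o b w + 1 :=
    pullCount_le_add_one β T D hδ ho (by omega) (hsub hi) (hsub hbA)
  set n := pullCount o i w - 1 with hn
  have hnpos : 0 < n := by omega
  have hnT : n ≤ T := by
    have := pullCount_le o i w
    omega
  have h1 : (delayedSample D (initialSegment o t) s i).Nonempty :=
    Finset.card_pos.1 (by rw [hcard]; omega)
  have h2 : (delayedSample D (initialSegment o t) s b).Nonempty :=
    Finset.card_pos.1 (by rw [hcard]; omega)
  have h3 : empiricalUtility β D (initialSegment o t) s b -
      confidenceRadius T D δ (initialSegment o t) s b ≤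
      empiricalUtility β D (initialSegment o t) s i +
      confidenceRadius T D δ (initialSegment o t) s i := by
    by_contra! hlt
    exact hel ⟨b, hbA, h1, h2, hlt⟩
  have h4 := abs_le.1 (abs_empiricalUtility_sub_le hβ hD hc hst ht h1)
  have h5 := abs_le.1 (abs_empiricalUtility_sub_le hβ hD hc hst ht h2)
  have hn0 : (0 : ℝ) < n := by exact_mod_cast hnpos
  have hrad : ∀ k, n ≤ pullCount o k w → confidenceRadius T D δ (initialSegment o t) s k ≤
      2 * √(2 * Real.log T / n) := by
    intro k hk
    unfold confidenceRadius
    rw [hcard]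
    have hk' : (n : ℝ) ≤ pullCount o k w := by exact_mod_cast hk
    have h6 : √(2 * Real.log T / pullCount o k w) ≤ √(2 * Real.log T / n) :=
      Real.sqrt_le_sqrt (div_le_div_of_nonneg_left (by positivity) hn0 hk')
    -- The perturbation is dominated by the statistical radius, as `n ≤ T` and `2 log T ≥ 1`.
    have h7 : (1 : ℝ) / T ≤ √(2 * Real.log T / n) := by
      refine Real.le_sqrt_of_sq_le ?_
      have hT2 : (2 : ℝ) ≤ T := by exact_mod_cast hT
      have hl2 : Real.log 2 ≤ Real.log T := Real.log_le_log (by norm_num) hT2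
      have hl := Real.log_two_gt_d9
      have hnT' : (n : ℝ) ≤ T := by exact_mod_cast hnT
      rw [div_pow, one_pow, div_le_div_iff₀ (by positivity) hn0]
      nlinarith
    linarith
  have h8 := hrad i (by omega)
  have h9 := hrad b (by omega)
  -- Overlapping intervals put the true means within two radii of each arm, and each radius is at
  -- most `2 √(2 log T / n)`. Squaring gives the constant 128.
  have h10 : g ≤ 8 * √(2 * Real.log T / n) := by
    change (1 - β b) * x b - (1 - β i) * x i ≤ _
    linarith [h4.1, h5.2]
  have h11 : g ^ 2 ≤ 128 * Real.log T / n := by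
    calc g ^ 2 ≤ (8 * √(2 * Real.log T / n)) ^ 2 := by gcongr
      _ = 128 * Real.log T / n := by
        rw [mul_pow, Real.sq_sqrt (by positivity)]
        ring
  have h12 : (n : ℝ) ≤ 128 * Real.log T / g ^ 2 := by
    rw [le_div_iff₀ hn0] at h11
    rw [le_div_iff₀ (by positivity)]
    linarith
  have h13 : (pullCount o i w : ℝ) = n + 1 := by
    have : pullCount o i w = n + 1 := by omega
    exact_mod_cast this
  linarith

/-- The arm survived the test before the pass of its last pull. Its pulls are those in the delayed
sample of that test, those in the delay window, one in the pass that ended with the test, and the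
last one. The window is shared by at least `r.card + 1` active arms: those in `r` and the best arm
`b`. -/
lemma pullCount_le_of_last_pull (hβ : ∀ i, β i ∈ Icc (0 : ℝ) 1) (hT : 2 ≤ T) (hD : 0 ≤ D)
    (hδ : 0 ≤ δ) (hδT : δ ≤ 1 / T) (ho : FollowsElimination β T D δ o)
    (hc : IsConcentrated T δ x o) {i b : Fin K} (hb : ∀ i, (1 - β i) * x i ≤ (1 - β b) * x b)
    (hgap : 0 < (1 - β b) * x b - (1 - β i) * x i) {e : ℕ} (he : e < T) (hei : (o e).1 = i)
    (hpull : pullCount o i T = pullCount o i (e + 1)) {r : Finset (Fin K)}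
    (hr : r ⊆ activeArms β T D δ o e) (hbr : b ∉ r) :
    (pullCount o i T : ℝ) ≤ 128 * Real.log T / ((1 - β b) * x b - (1 - β i) * x i) ^ 2 + 4 +
      (D + 1) * (1 / ((r.card : ℝ) + 1)) := by
  have hlog : 0 < Real.log T := Real.log_pos (by exact_mod_cast hT)
  have h0 : 0 ≤ 128 * Real.log T / ((1 - β b) * x b - (1 - β i) * x i) ^ 2 := by positivity
  have h0' : 0 ≤ (D + 1) * (1 / ((r.card : ℝ) + 1)) := by positivity
  have h1 := pullCount_succ_passStart β T D hδ ho he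
  rw [hei] at h1
  by_cases hs : passStart β T D δ o e = 0
  · rw [hs, pullCount_zero] at h1
    rw [hpull, h1]
    push_cast
    linarith
  obtain ⟨u, h2, h3, h4, h5⟩ := exists_previous_pass β T D o e hs
  have hie : i ∈ activeArms β T D δ o e := by
    have := nextArm_mem_activeArms β T D o hδ e
    rwa [← ho e he, hei] at this
  rw [h5] at hie hr
  obtain ⟨hiu, hel⟩ := (mem_activeArms_succ_of_eq β T D δ o h4 i).1 hie
  have hbu := optimal_mem_activeArms hβ hD hc hb (show u ≤ T by omega)
  have hN := pullCount_pass_end β T D hδ ho (by omega) h4 hiu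
  have hdelay := pullCount_le_of_not_isEliminated hβ hT hD hδ hδT ho hc (Nat.le_succ u)
    (by omega) hiu hbu hgap hel
  have hw : ⌈(passStart β T D δ o u : ℝ) - D - 1⌉₊ ≤ passStart β T D δ o u :=
    Nat.ceil_le.2 (by linarith)
  have hwin := card_mul_pullCount_sub_le β T D hδ ho (by omega) hw hiu
  have hceil := Nat.le_ceil ((passStart β T D δ o u : ℝ) - D - 1)
  have hcard : r.card + 1 ≤ (activeArms β T D δ o u).card := by
    rw [← Finset.card_insert_of_notMem hbr]
    refine Finset.card_le_card (Finset.insert_subset hbu ?_)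
    exact hr.trans (activeArms_antitone β T D δ o (Nat.le_succ u))
  have hcard' : (r.card : ℝ) + 1 ≤ (activeArms β T D δ o u).card := by exact_mod_cast hcard
  set s := passStart β T D δ o u
  set w := ⌈(s : ℝ) - D - 1⌉₊
  have hr0 : (0 : ℝ) < (r.card : ℝ) + 1 := by positivity
  have hq : (pullCount o i s : ℝ) - pullCount o i w - 1 ≤ (D + 1) * (1 / ((r.card : ℝ) + 1)) := by
    by_cases hneg : (pullCount o i s : ℝ) - pullCount o i w - 1 ≤ 0
    · linarith
    · rw [mul_one_div, le_div_iff₀ hr0]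
      nlinarith
  have hfin : (pullCount o i T : ℝ) = pullCount o i s + 2 := by
    have : pullCount o i T = pullCount o i s + 2 := by rw [hpull, h1, h2, hN]
    exact_mod_cast this
  linarith

/-- The regret of delayed elimination along a sequence of concentrated observations. -/
lemma sum_gap_le (hβ : ∀ i, β i ∈ Icc (0 : ℝ) 1) (hT : 2 ≤ T) (hD : 0 ≤ D)
    (hδ : 0 ≤ δ) (hδT : δ ≤ 1 / T) (ho : FollowsElimination β T D δ o)
    (hc : IsConcentrated T δ x o) {b : Fin K} (hb : ∀ i, (1 - β i) * x i ≤ (1 - β b) * x b)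
    {Δ : Fin K → ℝ} (hΔ : ∀ i, Δ i = (1 - β b) * x b - (1 - β i) * x i) {G : ℝ}
    (hG : ∀ i, Δ i ≤ G) :
    ∑ j ∈ Finset.range T, Δ (o j).1 ≤ (∑ i with 0 < Δ i, (128 * Real.log T / Δ i + 4 * Δ i)) +
      (D + 1) * G * Real.log ((Finset.univ.filter fun i => 0 < Δ i).card + 1) := by
  classical
  have hlog : 0 < Real.log T := Real.log_pos (by exact_mod_cast hT)
  have hΔ0 : ∀ i, 0 ≤ Δ i := fun i => by rw [hΔ]; linarith [hb i]
  have hG0 : 0 ≤ G := (hΔ0 b).trans (hG b)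
  set sub := Finset.univ.filter fun i => 0 < Δ i with hsub
  set pulled := sub.filter fun i => pullCount o i T ≠ 0 with hpulled
  -- The round of the last pull; for arms outside `pulled` the value 0 is a dummy.
  have hlast : ∀ i, ∃ e, i ∈ pulled →
      e < T ∧ (o e).1 = i ∧ pullCount o i T = pullCount o i (e + 1) := by
    intro i
    by_cases hi : i ∈ pulled
    · obtain ⟨e, he⟩ := exists_last_pull o i T (Finset.mem_filter.1 hi).2
      exact ⟨e, fun _ => he⟩
    · exact ⟨0, fun h => absurd h hi⟩
  choose e he using hlast
  have hinj : Set.InjOn e pulled := by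
    intro i hi k hk h
    rw [← (he i hi).2.1, ← (he k hk).2.1, h]
  have hbound : ∀ i ∈ pulled, (pullCount o i T : ℝ) * Δ i ≤
      (128 * Real.log T / Δ i + 4 * Δ i) +
      (D + 1) * G * (1 / (((pulled.filter fun k => e i ≤ e k).card : ℝ) + 1)) := by
    intro i hi
    have hpos : 0 < Δ i := by simpa [hsub] using (Finset.mem_filter.1 hi).1
    -- The arms whose last pull is not before that of `i` are all still active at round `e i`.
    have h1 := pullCount_le_of_last_pull hβ hT hD hδ hδT ho hc hb (by rw [← hΔ]; exact hpos)
      (he i hi).1 (he i hi).2.1 (he i hi).2.2 (r := pulled.filter fun k => e i ≤ e k) ?_ ?_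
    · rw [← hΔ] at h1
      calc (pullCount o i T : ℝ) * Δ i ≤ (128 * Real.log T / Δ i ^ 2 + 4 +
            (D + 1) * (1 / (((pulled.filter fun k => e i ≤ e k).card : ℝ) + 1))) * Δ i := by
            gcongr
        _ = (128 * Real.log T / Δ i + 4 * Δ i) +
            (D + 1) * Δ i * (1 / (((pulled.filter fun k => e i ≤ e k).card : ℝ) + 1)) := by
            field_simp
        _ ≤ _ := by
            gcongr
            exact hG i
    · intro k hk
      obtain ⟨hk1, hk2⟩ := Finset.mem_filter.1 hk
      have := nextArm_mem_activeArms β T D o hδ (e k)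
      rw [← ho _ (he k hk1).1, (he k hk1).2.1] at this
      exact activeArms_antitone β T D δ o hk2 this
    · intro hbr
      have := (Finset.mem_filter.1 (Finset.mem_filter.1 (Finset.mem_filter.1 hbr).1).1).2
      rw [hΔ] at this
      simp at this
  have hterm : ∀ i ∈ sub, 0 ≤ 128 * Real.log T / Δ i + 4 * Δ i := by
    intro i hi
    have hpos : 0 < Δ i := by simpa [hsub] using hi
    positivity
  rw [← sum_pullCount_mul]
  calc ∑ i, (pullCount o i T : ℝ) * Δ i = ∑ i ∈ pulled, (pullCount o i T : ℝ) * Δ i := by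
        symm
        refine Finset.sum_subset (Finset.subset_univ _) fun i _ hi => ?_
        simp only [hpulled, hsub, Finset.mem_filter, Finset.mem_univ, true_and, not_and_or,
          not_lt, not_not] at hi
        rcases hi with hi | hi
        · rw [le_antisymm hi (hΔ0 i), mul_zero]
        · simp [hi]
    _ ≤ ∑ i ∈ pulled, ((128 * Real.log T / Δ i + 4 * Δ i) +
          (D + 1) * G * (1 / (((pulled.filter fun k => e i ≤ e k).card : ℝ) + 1))) :=
        Finset.sum_le_sum hbound
    _ = (∑ i ∈ pulled, (128 * Real.log T / Δ i + 4 * Δ i)) + (D + 1) * G *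
          ∑ i ∈ pulled, 1 / (((pulled.filter fun k => e i ≤ e k).card : ℝ) + 1) := by
        rw [Finset.sum_add_distrib, Finset.mul_sum]
    _ ≤ (∑ i ∈ sub, (128 * Real.log T / Δ i + 4 * Δ i)) + (D + 1) * G *
          Real.log (sub.card + 1) := by
        have h1 : ∑ i ∈ pulled, (128 * Real.log T / Δ i + 4 * Δ i) ≤
            ∑ i ∈ sub, (128 * Real.log T / Δ i + 4 * Δ i) :=
          Finset.sum_le_sum_of_subset_of_nonneg (Finset.filter_subset _ _)
            fun i hi _ => hterm i hi
        have h2 := sum_inv_card_filter_le_log e pulled hinj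
        have h3 : Real.log ((pulled.card : ℝ) + 1) ≤ Real.log ((sub.card : ℝ) + 1) := by
          refine Real.log_le_log (by positivity) ?_
          have : pulled.card ≤ sub.card := Finset.card_filter_le _ _
          have : (pulled.card : ℝ) ≤ sub.card := by exact_mod_cast this
          linarith
        have h4 : 0 ≤ (D + 1) * G := by positivity
        exact add_le_add h1 (mul_le_mul_of_nonneg_left (h2.trans h3) h4)

/-- Within the first pass every arm is pulled at most once. -/
lemma sum_gap_le_of_le_card (hδ : 0 ≤ δ) (ho : FollowsElimination β T D δ o) (hTK : T ≤ K)
    {Δ : Fin K → ℝ} (hΔ : ∀ i, 0 ≤ Δ i) :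
    ∑ j ∈ Finset.range T, Δ (o j).1 ≤ ∑ i with 0 < Δ i, Δ i := by
  have hone : ∀ i, pullCount o i T ≤ 1 := by
    intro i
    by_cases hi : pullCount o i T = 0
    · omega
    obtain ⟨e, he, rfl, h⟩ := exists_last_pull o i T hi
    rw [h, pullCount_succ_passStart β T D hδ ho he,
      (passStart_eq_zero_of_lt β T D o (he.trans_le hTK)).1, pullCount_zero]
  rw [← sum_pullCount_mul, Finset.sum_filter]
  refine Finset.sum_le_sum fun i _ => ?_
  have h1 : (pullCount o i T : ℝ) ≤ 1 := by exact_mod_cast hone i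
  split_ifs with h
  · nlinarith
  · rw [le_antisymm (not_lt.1 h) (hΔ i), mul_zero]

end Elimination

/-! ### The delay of the agent's influence -/

section Influence

variable {K : ℕ} (β : Fin K → ℝ) (T : ℕ) (D δ : ℝ)

lemma eliminationState_fst_le (t : ℕ) (h : Fin t → Obs K) : (eliminationState β T D δ t h).1 ≤ t := by
  induction t with
  | zero => rfl
  | succ t ih =>
    simp only [eliminationState]
    split_ifs
    · exact le_rfl
    · exact (ih _).trans (Nat.le_succ t)

lemma isEliminated_congr {t s : ℕ} {h h' : Fin t → Obs K}
    (hh : ∀ j : Fin t, (j : ℝ) + 1 < s - D → h j = h' j) (A : Finset (Fin K)) (i : Fin K) :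
    IsEliminated β T D δ h s A i ↔ IsEliminated β T D δ h' s A i := by
  have h1 : ∀ i, delayedSample D h s i = delayedSample D h' s i := by
    intro i
    refine Finset.filter_congr fun j _ => and_congr_right fun hj => ?_
    rw [hh j (by push_cast at hj; exact hj)]
  have h2 : ∀ i, empiricalUtility β D h s i = empiricalUtility β D h' s i := by
    intro i
    unfold empiricalUtility
    rw [h1]
    congr 1
    refine Finset.sum_congr rfl fun j hj => ?_
    have hj' := (Finset.mem_filter.1 hj).2.1
    push_cast at hj'
    rw [hh j hj']
  unfold IsEliminated confidenceRadius
  simp only [h1, h2]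

/-- The state after `t` rounds depends only on the rounds before `t - 1 - D`. -/
lemma eliminationState_congr {t : ℕ} {h h' : Fin t → Obs K}
    (hh : ∀ j : Fin t, (j : ℝ) + 1 < t - 1 - D → h j = h' j) :
    eliminationState β T D δ t h = eliminationState β T D δ t h' := by
  induction t with
  | zero => rfl
  | succ t ih =>
    have h1 : eliminationState β T D δ t (fun j => h j.castSucc) =
        eliminationState β T D δ t (fun j => h' j.castSucc) := by
      refine ih fun j hj => hh _ ?_
      push_cast [Fin.val_castSucc]
      linarith
    simp only [eliminationState, h1]
    split_ifs with h2
    · congr 1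
      ext i
      refine (@Finset.mem_filter _ _ (_) _ _).trans
        (Iff.trans ?_ (@Finset.mem_filter _ _ (_) _ _).symm)
      rw [h1]
      -- The delay of the test counts back from the start of the pass, which is at most `t`; this is
      -- why the bound for the state at `t + 1` can be `t - D`.
      refine and_congr_right fun _ => not_congr (isEliminated_congr β T D δ ?_ _ i)
      intro j hj
      refine hh j (hj.trans_le ?_)
      have := eliminationState_fst_le β T D δ t (fun j => h' j.castSucc)
      have : ((eliminationState β T D δ t (fun j => h' j.castSucc)).1 : ℝ) ≤ t := by
        exact_mod_cast this
      push_cast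
      linarith
    · rfl

lemma nextArm_congr [NeZero K] {t : ℕ} {h h' : Fin t → Obs K}
    (hh : ∀ j : Fin t, (j : ℝ) + 1 < t - 1 - D → h j = h' j) :
    nextArm β T D δ t h = nextArm β T D δ t h' := by
  unfold nextArm
  rw [eliminationState_congr β T D δ hh]

end Influence

/-! ### The law of the history -/

lemma measurable_snoc_prod {α : Type*} [MeasurableSpace α] (t : ℕ) :
    Measurable (fun p : (Fin t → α) × α => Fin.snoc (α := fun _ => α) p.1 p.2) := by
  refine measurable_pi_iff.2 fun j => ?_
  refine Fin.lastCases ?_ (fun j => ?_) j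
  · simpa using measurable_snd
  · simp only [Fin.snoc_castSucc]
    exact (measurable_pi_apply j).comp measurable_fst

/-- The first `t` rounds of a history. -/
def past {α : Type*} {t T : ℕ} (ht : t ≤ T) (h : Fin T → α) : Fin t → α :=
  fun j => h (Fin.castLE ht j)

lemma measurable_past {α : Type*} [MeasurableSpace α] {t T : ℕ} (ht : t ≤ T) :
    Measurable (past ht : (Fin T → α) → Fin t → α) :=
  measurable_pi_iff.2 fun _ => measurable_pi_apply _

lemma past_snoc {α : Type*} {t T : ℕ} (ht : t ≤ T) (h : Fin T → α) (r : α) :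
    past (ht.trans (Nat.le_succ T)) (Fin.snoc (α := fun _ => α) h r) = past ht h := by
  funext j
  exact Fin.snoc_castSucc (α := fun _ => α) r h (Fin.castLE ht j)

section Law

variable {K : ℕ} {E : ℝ} (P : Kernel (Icc (0 : ℝ) E) I) [IsMarkovKernel P] (M : Mechanism K)
  (S : Strategy K E)

instance isMarkovKernel_roundKernel (t : ℕ) : IsMarkovKernel (roundKernel P M S t) := by
  have := M.markov t
  have := S.markov t
  unfold roundKernel
  infer_instance

instance isProbabilityMeasure_historyLaw (t : ℕ) : IsProbabilityMeasure (historyLaw P M S t) := by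
  induction t with
  | zero => simp only [historyLaw]; infer_instance
  | succ t ih =>
    simp only [historyLaw]
    exact Measure.isProbabilityMeasure_map (measurable_snoc_prod t).aemeasurable

lemma lintegral_historyLaw_succ (t : ℕ) {f : (Fin (t + 1) → Round K E) → ENNReal}
    (hf : Measurable f) :
    ∫⁻ h, f h ∂(historyLaw P M S (t + 1)) =
      ∫⁻ h, ∫⁻ r, f (Fin.snoc (α := fun _ => Round K E) h r) ∂(roundKernel P M S t h)
        ∂(historyLaw P M S t) := by
  simp only [historyLaw]
  rw [lintegral_map hf (measurable_snoc_prod t),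
    Measure.lintegral_compProd (by exact hf.comp (measurable_snoc_prod t))]

lemma map_past_historyLaw {t T : ℕ} (ht : t ≤ T) :
    (historyLaw P M S T).map (past ht) = historyLaw P M S t := by
  induction T, ht using Nat.le_induction with
  | base =>
    have : (past le_rfl : (Fin t → Round K E) → _) = id := rfl
    rw [this, Measure.map_id]
  | succ T hT ih =>
    simp only [historyLaw]
    rw [Measure.map_map (measurable_past _) (measurable_snoc_prod T)]
    have : (past (hT.trans (Nat.le_succ T)) : (Fin (T + 1) → Round K E) → _) ∘
        (fun p : (Fin T → Round K E) × Round K E =>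
          Fin.snoc (α := fun _ => Round K E) p.1 p.2) = past hT ∘ Prod.fst := by
      funext p
      exact past_snoc hT p.1 p.2
    rw [this, ← Measure.map_map (measurable_past _) measurable_fst]
    have h2 : ((historyLaw P M S T) ⊗ₘ (roundKernel P M S T)).map Prod.fst =
        historyLaw P M S T := Measure.fst_compProd _ _
    rw [h2, ih]

lemma integral_past {t T : ℕ} (ht : t ≤ T) {f : (Fin t → Round K E) → ℝ} (hf : Measurable f) :
    ∫ h, f (past ht h) ∂(historyLaw P M S T) = ∫ h, f h ∂(historyLaw P M S t) := by
  rw [← map_past_historyLaw P M S ht,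
    integral_map (measurable_past ht).aemeasurable hf.aestronglyMeasurable]

lemma ae_past {t T : ℕ} (ht : t ≤ T) {p : (Fin t → Round K E) → Prop}
    (hp : ∀ᵐ h ∂(historyLaw P M S t), p h) : ∀ᵐ h ∂(historyLaw P M S T), p (past ht h) := by
  rw [← map_past_historyLaw P M S ht] at hp
  exact ae_of_ae_map (measurable_past ht).aemeasurable hp

lemma integral_round {T : ℕ} (j : Fin T) {g : Round K E → ℝ} (hg : Measurable g) {C : ℝ}
    (hC : ∀ r, |g r| ≤ C) :
    ∫ h, g (h j) ∂(historyLaw P M S T) =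
      ∫ h, ∫ r, g r ∂(roundKernel P M S j h) ∂(historyLaw P M S j) := by
  have hj : (j : ℕ) + 1 ≤ T := j.2
  have hm : Measurable fun h : Fin (j + 1) → Round K E => g (h (Fin.last j)) :=
    hg.comp (measurable_pi_apply _)
  have h1 := integral_past P M S hj hm
  refine Eq.trans ?_ (h1.trans ?_)
  · rfl
  simp only [historyLaw]
  rw [integral_map (measurable_snoc_prod _).aemeasurable
    hm.aestronglyMeasurable]
  simp only [Fin.snoc_last]
  rw [Measure.integral_compProd]
  exact Integrable.of_bound (hg.comp measurable_snd).aestronglyMeasurable C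
    (Filter.Eventually.of_forall fun p => hC p.2)

/-- If the conditional expectations of nonnegative multipliers are at most one, so is the
expectation of their product. -/
lemma lintegral_prod_le_one {T : ℕ} {w : Round K E → ENNReal} (hw : Measurable w)
    (h1 : ∀ t < T, ∀ᵐ h ∂(historyLaw P M S t), ∫⁻ r, w r ∂(roundKernel P M S t h) ≤ 1)
    {t : ℕ} (ht : t ≤ T) : ∫⁻ h, ∏ j, w (h j) ∂(historyLaw P M S t) ≤ 1 := by
  induction t with
  | zero => simp
  | succ t ih =>
    rw [lintegral_historyLaw_succ P M S t
      (f := fun h => ∏ j, w (h j))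
      (Finset.measurable_fun_prod _ fun j _ => hw.comp (measurable_pi_apply j))]
    refine (lintegral_mono_ae ?_).trans (ih (by omega))
    filter_upwards [h1 t (by omega)] with h hh
    simp only [Fin.prod_univ_castSucc, Fin.snoc_castSucc, Fin.snoc_last]
    rw [lintegral_const_mul _ hw]
    exact mul_le_of_le_one_right zero_le hh

end Law

/-! ### Deterministic mechanisms -/

section Deterministic

variable {K : ℕ} {E : ℝ} {arm : (t : ℕ) → (Fin t → Obs K) → Fin K}
  (harm : ∀ t, Measurable (arm t))

/-- The law of the effort given the history, when the next contract is a function of the observed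
history. -/
noncomputable def effortKernel (S : Strategy K E) (t : ℕ) :
    Kernel (Fin t → Round K E) (Icc (0 : ℝ) E) :=
  (S.kernel t).comap (fun h => (h, arm t (publicPart h)))
    (measurable_id.prodMk ((harm t).comp measurable_publicPart))

instance isMarkovKernel_effortKernel (S : Strategy K E) (t : ℕ) :
    IsMarkovKernel (effortKernel harm S t) := by
  have := S.markov t
  unfold effortKernel
  infer_instance

variable (P : Kernel (Icc (0 : ℝ) E) I) [IsMarkovKernel P] {M : Mechanism K}
  (hM : ∀ t, M.kernel t = Kernel.deterministic (arm t) (harm t)) (S : Strategy K E)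

include hM in
lemma roundKernel_apply (t : ℕ) (h : Fin t → Round K E) :
    roundKernel P M S t h = ((effortKernel harm S t h) ⊗ₘ P).map
      (fun p => ((arm t (publicPart h), p.1), p.2)) := by
  have := M.markov t
  have := S.markov t
  have hmeas : Measurable (fun p : Icc (0 : ℝ) E × I =>
      (((arm t (publicPart h), p.1), p.2) : Round K E)) := by fun_prop
  refine Measure.ext_of_lintegral _ fun f hf => ?_
  rw [lintegral_map hf hmeas, Measure.lintegral_compProd (by exact hf.comp hmeas)]
  unfold roundKernel
  rw [Kernel.lintegral_compProd _ _ _ hf, Kernel.lintegral_compProd _ _ _ (by fun_prop),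
    Kernel.comap_apply, hM t, Kernel.lintegral_deterministic' _ (measurable_of_finite _)]
  rfl

include hM in
lemma integral_roundKernel (t : ℕ) (h : Fin t → Round K E) {g : Round K E → ℝ}
    (hg : Measurable g) {C : ℝ} (hC : ∀ r, |g r| ≤ C) :
    ∫ r, g r ∂(roundKernel P M S t h) =
      ∫ a, ∫ y, g ((arm t (publicPart h), a), y) ∂(P a) ∂(effortKernel harm S t h) := by
  have hmeas : Measurable (fun p : Icc (0 : ℝ) E × I =>
      (((arm t (publicPart h), p.1), p.2) : Round K E)) := by fun_prop
  rw [roundKernel_apply harm P hM S, integral_map hmeas.aemeasurable hg.aestronglyMeasurable,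
    Measure.integral_compProd]
  exact Integrable.of_bound (hg.comp hmeas).aestronglyMeasurable C
    (Filter.Eventually.of_forall fun p => hC _)

include hM in
lemma ae_roundKernel_fst (t : ℕ) (h : Fin t → Round K E) :
    ∀ᵐ r ∂(roundKernel P M S t h), r.1.1 = arm t (publicPart h) := by
  have hmeas : Measurable (fun p : Icc (0 : ℝ) E × I =>
      (((arm t (publicPart h), p.1), p.2) : Round K E)) := by fun_prop
  rw [roundKernel_apply harm P hM S, ae_map_iff hmeas.aemeasurable]
  · exact Filter.Eventually.of_forall fun p => rfl
  · exact (measurable_fst.comp measurable_fst) (MeasurableSet.singleton _)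

include hM in
/-- Almost surely the contracts in the history are those that the mechanism posts. -/
lemma ae_contract_eq {T : ℕ} : ∀ᵐ h ∂(historyLaw P M S T),
    ∀ j : Fin T, (h j).1.1 = arm j (publicPart (past j.2.le h)) := by
  refine ae_all_iff.2 fun j => ?_
  have hj : (j : ℕ) + 1 ≤ T := j.2
  have h0 : MeasurableSet {h : Fin (j + 1) → Round K E |
      (h (Fin.last j)).1.1 = arm j (publicPart (past (Nat.le_succ j) h))} := by
    refine measurableSet_eq_fun (by fun_prop) ?_
    exact (harm j).comp (measurable_publicPart.comp (measurable_past _))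
  have h1 : ∀ᵐ h ∂(historyLaw P M S (j + 1)),
      (h (Fin.last j)).1.1 = arm j (publicPart (past (Nat.le_succ j) h)) := by
    simp only [historyLaw]
    rw [ae_map_iff (measurable_snoc_prod _).aemeasurable h0, Measure.ae_compProd_iff]
    · refine Filter.Eventually.of_forall fun h => ?_
      filter_upwards [ae_roundKernel_fst harm P hM S j h] with r hr
      have := past_snoc (le_refl (j : ℕ)) h r
      simp only [Fin.snoc_last]
      rw [this]
      exact hr
    · exact (measurable_snoc_prod _) h0
  exact ae_past P M S hj h1

/-- The expected utility of the agent in a round, given the history before it. -/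
noncomputable def stageReward (β : Fin K → ℝ) (c : ℝ → ℝ) (t : ℕ)
    (h : Fin t → Round K E) : ℝ :=
  ∫ a, (β (arm t (publicPart h)) * (a : ℝ) - c a) ∂(effortKernel harm S t h)

/-- The expected effort in a round, given the history before it. -/
noncomputable def meanEffort (t : ℕ) (h : Fin t → Round K E) : ℝ :=
  ∫ a, (a : ℝ) ∂(effortKernel harm S t h)

lemma measurable_meanEffort (t : ℕ) : Measurable (meanEffort harm S t) :=
  (StronglyMeasurable.integral_kernel_prod_right' (κ := effortKernel harm S t)
    (f := fun p : (Fin t → Round K E) × Icc (0 : ℝ) E => (p.2 : ℝ))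
    (by fun_prop : Measurable _).stronglyMeasurable).measurable

variable {c : ℝ → ℝ} (hc : Measurable (fun a : Icc (0 : ℝ) E => c a)) (β : Fin K → ℝ)

include hc in
lemma measurable_stageReward (t : ℕ) : Measurable (stageReward harm S β c t) := by
  have h1 : Measurable (fun p : (Fin t → Round K E) × Icc (0 : ℝ) E =>
      β (arm t (publicPart p.1)) * (p.2 : ℝ) - c p.2) :=
    (((measurable_of_finite β).comp ((harm t).comp
      (measurable_publicPart.comp measurable_fst))).mul (by fun_prop)).sub
      (hc.comp measurable_snd)
  exact (StronglyMeasurable.integral_kernel_prod_right' (κ := effortKernel harm S t)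
    h1.stronglyMeasurable).measurable

lemma integrable_unitInterval (ν : Measure I) [IsFiniteMeasure ν] :
    Integrable (fun y : I => (y : ℝ)) ν :=
  Integrable.of_bound (by fun_prop : Measurable _).aestronglyMeasurable 1
    (Filter.Eventually.of_forall fun y => by
      rw [Real.norm_eq_abs, abs_of_nonneg y.2.1]; exact y.2.2)

lemma integrable_effort (ν : Measure (Icc (0 : ℝ) E)) [IsFiniteMeasure ν] :
    Integrable (fun a : Icc (0 : ℝ) E => (a : ℝ)) ν :=
  Integrable.of_bound (by fun_prop : Measurable _).aestronglyMeasurable E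
    (Filter.Eventually.of_forall fun a => by
      rw [Real.norm_eq_abs, abs_of_nonneg a.2.1]; exact a.2.2)

variable (hP : ∀ a : Icc (0 : ℝ) E, ∫ y, (y : ℝ) ∂(P a) = (a : ℝ))

include hP hc hM in
-- The utility is linear in the output, so conditioning on the effort replaces `y` by its mean `a`.
-- Strategies can then be compared round by round through their stage rewards.
lemma agentUtility_eq_sum {C : ℝ} (hC : ∀ a : Icc (0 : ℝ) E, |c a| ≤ C) (γ : ℝ) (T : ℕ) :
    agentUtility β c P γ T M S = ∑ t ∈ Finset.range T,
      γ ^ (t + 1) * ∫ h, stageReward harm S β c t h ∂(historyLaw P M S t) := by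
  obtain ⟨B, hB⟩ : ∃ B : ℝ, ∀ i, |β i| ≤ B :=
    ⟨∑ i, |β i|, fun i => Finset.single_le_sum (f := fun i => |β i|)
      (fun i _ => abs_nonneg _) (Finset.mem_univ i)⟩
  have hg : Measurable (fun r : Round K E => β r.1.1 * (r.2 : ℝ) - c r.1.2) :=
    (((measurable_of_finite β).comp (by fun_prop : Measurable fun r : Round K E => r.1.1)).mul
      (by fun_prop)).sub (hc.comp (by fun_prop))
  have hbd : ∀ r : Round K E, |β r.1.1 * (r.2 : ℝ) - c r.1.2| ≤ B + C := by
    intro r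
    refine (abs_sub _ _).trans (add_le_add ?_ (hC _))
    rw [abs_mul, abs_of_nonneg r.2.2.1]
    exact (mul_le_of_le_one_right (abs_nonneg _) r.2.2.2).trans (hB _)
  unfold agentUtility
  rw [integral_finsetSum]
  · rw [Finset.sum_range]
    refine Finset.sum_congr rfl fun j _ => ?_
    rw [integral_const_mul]
    congr 1
    rw [integral_round P M S j hg hbd]
    refine integral_congr_ae (Filter.Eventually.of_forall fun h => ?_)
    simp only
    rw [integral_roundKernel harm P hM S _ _ hg hbd]
    unfold stageReward
    refine integral_congr_ae (Filter.Eventually.of_forall fun a => ?_)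
    simp only
    rw [integral_sub ((integrable_unitInterval _).const_mul _) (integrable_const _),
      integral_const_mul, hP]
    simp
  · intro j _
    refine Integrable.const_mul ?_ _
    exact Integrable.of_bound (hg.comp (measurable_pi_apply j)).aestronglyMeasurable (B + C)
      (Filter.Eventually.of_forall fun h => hbd (h j))

end Deterministic

/-! ### Best responses -/

section StageGame

variable {E lam b a : ℝ} {c : ℝ → ℝ}

/-- The objective is strongly concave, so it drops quadratically away from its maximizer. Comparing
the maximizer with `(1 - s) a + s a'` gives `(1 - s) q ≤ d`, with `q` the quadratic term and `d` the
loss; no differentiability is needed. -/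
lemma IsBestResponse.add_sq_le (hc : StrongConvexOn (Icc (0 : ℝ) E) lam c)
    (ha : IsBestResponse E c b a) {a' : ℝ} (ha' : a' ∈ Icc (0 : ℝ) E) :
    b * a' - c a' + lam / 2 * (a' - a) ^ 2 ≤ b * a - c a := by
  have hd := ha.2 a' ha'
  set q := lam / 2 * (a' - a) ^ 2 with hq
  by_contra! hlt
  set d := (b * a - c a) - (b * a' - c a') with hdd
  have hd0 : 0 ≤ d := by linarith
  have hdq : d < q := by linarith
  have hq0 : 0 < q := by linarith
  -- If `d < q`, this `s` makes `(1 - s) q` the midpoint of `d` and `q`, which exceeds `d`. It takes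
  -- the place of the limit `s → 0`.
  set s := (q - d) / (2 * q) with hs
  have hs0 : 0 < s := div_pos (by linarith) (by linarith)
  have hs1 : s ≤ 1 / 2 := by rw [hs, div_le_iff₀ (by linarith)]; linarith
  have hsq : s * q = (q - d) / 2 := by rw [hs]; field_simp
  have h1 := hc.2 ha.1 ha' (show 0 ≤ 1 - s by linarith) hs0.le (by ring)
  have h2 := ha.2 _ (hc.1 ha.1 ha' (show 0 ≤ 1 - s by linarith) hs0.le (by ring))
  simp only [smul_eq_mul, Real.norm_eq_abs, sq_abs] at h1 h2
  have h3 : lam / 2 * (a - a') ^ 2 = q := by rw [hq]; ring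
  rw [h3] at h1
  have h4 : s * ((1 - s) * q) ≤ s * d := by
    rw [hdd]
    nlinarith
  have h5 : (1 - s) * q ≤ d := le_of_mul_le_mul_left h4 hs0
  nlinarith

lemma isBestResponse_bestResponse (h : ∃ a, IsBestResponse E c b a) :
    IsBestResponse E c b (bestResponse E c b) := Classical.epsilon_spec h

lemma cost_nonneg (hE : 0 ≤ E) (hc0 : c 0 = 0) (hmono : MonotoneOn c (Icc (0 : ℝ) E))
    (ha : a ∈ Icc (0 : ℝ) E) : 0 ≤ c a := by
  rw [← hc0]
  exact hmono ⟨le_rfl, hE⟩ ha ha.1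

/-- Comparison with zero effort gives `λ/2 · a² ≤ b a - c a ≤ a`. This bounds all gaps by `2 / λ`,
which matters when `λ` is large. -/
lemma IsBestResponse.le_two_div (hE : 0 ≤ E) (hc0 : c 0 = 0)
    (hmono : MonotoneOn c (Icc (0 : ℝ) E))
    (hc : StrongConvexOn (Icc (0 : ℝ) E) lam c) (hlam : 0 < lam) (hb : b ≤ 1)
    (ha : IsBestResponse E c b a) : a ≤ 2 / lam := by
  have h1 := ha.add_sq_le hc (a' := 0) ⟨le_rfl, hE⟩
  have h2 := cost_nonneg hE hc0 hmono ha.1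
  rw [hc0] at h1
  rcases ha.1.1.eq_or_lt with h0 | h0
  · rw [← h0]; positivity
  · rw [le_div_iff₀ hlam]
    have h3 : b * a ≤ a := mul_le_of_le_one_left h0.le hb
    have h4 : lam / 2 * a * a ≤ 1 * a := by nlinarith
    have := le_of_mul_le_mul_right h4 h0
    linarith

end StageGame

/-! ### Deviations of the agent -/

open Classical in
/-- The strategy that follows `S`, except that it chooses the efforts `x` from round `τ + 1` on if
the history of the first `τ` rounds is in `B`. -/
noncomputable def deviate {K : ℕ} {E : ℝ} (S : Strategy K E) (τ : ℕ)
    {B : Set (Fin τ → Round K E)} (hB : MeasurableSet B) (x : Fin K → Icc (0 : ℝ) E) :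
    Strategy K E where
  kernel t := if ht : τ ≤ t then
      Kernel.piecewise (s := {p : (Fin t → Round K E) × Fin K | past ht p.1 ∈ B})
        (((measurable_past ht).comp measurable_fst) hB)
        (Kernel.deterministic (fun p => x p.2) ((measurable_of_finite x).comp measurable_snd))
        (S.kernel t)
    else S.kernel t
  markov t := by
    have := S.markov t
    split_ifs <;> infer_instance

section Deviation

variable {K : ℕ} {E : ℝ} {arm : (t : ℕ) → (Fin t → Obs K) → Fin K}
  (harm : ∀ t, Measurable (arm t)) (P : Kernel (Icc (0 : ℝ) E) I) [IsMarkovKernel P]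
  {M : Mechanism K} (hM : ∀ t, M.kernel t = Kernel.deterministic (arm t) (harm t))
  (S : Strategy K E) {τ : ℕ} {B : Set (Fin τ → Round K E)} (hB : MeasurableSet B)
  (x : Fin K → Icc (0 : ℝ) E)

lemma deviate_kernel_of_lt {t : ℕ} (ht : t < τ) : (deviate S τ hB x).kernel t = S.kernel t := by
  simp [deviate, not_le.2 ht]

lemma effortKernel_deviate_of_mem {t : ℕ} (ht : τ ≤ t) {h : Fin t → Round K E}
    (hh : past ht h ∈ B) : effortKernel harm (deviate S τ hB x) t h =
      Measure.dirac (x (arm t (publicPart h))) := by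
  unfold effortKernel deviate
  rw [Kernel.comap_apply]
  simp only [dif_pos ht]
  classical
  rw [Kernel.piecewise_apply, if_pos (by exact hh), Kernel.deterministic_apply]

lemma effortKernel_deviate_of_notMem {t : ℕ} (ht : τ ≤ t) {h : Fin t → Round K E}
    (hh : past ht h ∉ B) :
    effortKernel harm (deviate S τ hB x) t h = effortKernel harm S t h := by
  unfold effortKernel deviate
  rw [Kernel.comap_apply, Kernel.comap_apply]
  simp only [dif_pos ht]
  classical
  rw [Kernel.piecewise_apply, if_neg (by exact hh)]

omit [IsMarkovKernel P] in
lemma historyLaw_deviate {t : ℕ} (ht : t ≤ τ) :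
    historyLaw P M (deviate S τ hB x) t = historyLaw P M S t := by
  induction t with
  | zero => rfl
  | succ t ih =>
    simp only [historyLaw]
    rw [ih (by omega)]
    unfold roundKernel
    rw [deviate_kernel_of_lt S hB x ht]

include hM in
-- Whether the history is in `B` is settled after `τ` rounds, and outside `B` the deviation uses the
-- kernels of `S`. So the two laws differ only on continuations of `B`.
lemma lintegral_deviate_eq {t : ℕ} (ht : τ ≤ t) {f : (Fin t → Round K E) → ENNReal}
    (hf : Measurable f) (h0 : ∀ h, past ht h ∈ B → f h = 0) :
    ∫⁻ h, f h ∂(historyLaw P M (deviate S τ hB x) t) = ∫⁻ h, f h ∂(historyLaw P M S t) := by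
  induction t, ht using Nat.le_induction with
  | base => rw [historyLaw_deviate P S hB x le_rfl]
  | succ t ht ih =>
    rw [lintegral_historyLaw_succ _ _ _ _ hf, lintegral_historyLaw_succ _ _ _ _ hf]
    have hF : Measurable (fun h => ∫⁻ r, f (Fin.snoc (α := fun _ => Round K E) h r)
        ∂(roundKernel P M S t h)) :=
      Measurable.lintegral_kernel_prod_right' (hf.comp (measurable_snoc_prod t))
    have hz : ∀ h, past ht h ∈ B → ∀ r, f (Fin.snoc (α := fun _ => Round K E) h r) = 0 := by
      intro h hh r
      refine h0 _ ?_
      rw [past_snoc ht h r]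
      exact hh
    rw [← ih hF fun h hh => by simp [hz h hh]]
    refine lintegral_congr fun h => ?_
    by_cases hh : past ht h ∈ B
    · simp [hz h hh]
    · rw [roundKernel_apply harm P hM, roundKernel_apply harm P hM,
        effortKernel_deviate_of_notMem harm S hB x ht hh]

include hM in
lemma restrict_deviate_eq {t : ℕ} (ht : τ ≤ t) :
    (historyLaw P M (deviate S τ hB x) t).restrict (past ht ⁻¹' B)ᶜ =
      (historyLaw P M S t).restrict (past ht ⁻¹' B)ᶜ := by
  have hC : MeasurableSet (past ht ⁻¹' B)ᶜ := ((measurable_past ht) hB).compl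
  ext A hA
  rw [Measure.restrict_apply hA, Measure.restrict_apply hA, ← lintegral_indicator_one (hA.inter hC),
    ← lintegral_indicator_one (hA.inter hC)]
  refine lintegral_deviate_eq harm P hM S hB x ht (measurable_one.indicator (hA.inter hC)) ?_
  intro h hh
  exact Set.indicator_of_notMem (fun hmem => hmem.2 hh) _

variable {c : ℝ → ℝ} (hc : Measurable (fun a : Icc (0 : ℝ) E => c a)) (β : Fin K → ℝ)
  {R : ℝ} (hR : ∀ i, ∀ a : Icc (0 : ℝ) E, |β i * a - c a| ≤ R)

include hR in
lemma abs_stageReward_le (t : ℕ) (h : Fin t → Round K E) : |stageReward harm S β c t h| ≤ R := by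
  unfold stageReward
  have := norm_integral_le_of_norm_le_const (μ := effortKernel harm S t h)
    (f := fun a : Icc (0 : ℝ) E => β (arm t (publicPart h)) * (a : ℝ) - c a) (C := R)
    (Filter.Eventually.of_forall fun a => hR _ a)
  simpa using this

include hR hc in
lemma integrable_stageReward (t : ℕ) (μ : Measure (Fin t → Round K E)) [IsFiniteMeasure μ] :
    Integrable (stageReward harm S β c t) μ :=
  Integrable.of_bound (measurable_stageReward harm S hc β t).aestronglyMeasurable R
    (Filter.Eventually.of_forall fun h => abs_stageReward_le harm S β hR t h)

include hR hc in
lemma integrable_reward (i : Fin K) (ν : Measure (Icc (0 : ℝ) E)) [IsFiniteMeasure ν] :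
    Integrable (fun a : Icc (0 : ℝ) E => β i * (a : ℝ) - c a) ν :=
  Integrable.of_bound (((by fun_prop : Measurable fun a : Icc (0 : ℝ) E =>
    β i * (a : ℝ)).sub hc).aestronglyMeasurable) R (Filter.Eventually.of_forall fun a => hR i a)

variable {v : Fin K → ℝ} (hvx : ∀ i, v i = β i * x i - c (x i))
  (hv : ∀ i, ∀ a : Icc (0 : ℝ) E, β i * a - c a ≤ v i)

include hR hc hv in
lemma stageReward_le (t : ℕ) (h : Fin t → Round K E) :
    stageReward harm S β c t h ≤ v (arm t (publicPart h)) := by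
  unfold stageReward
  have := integral_mono (μ := effortKernel harm S t h)
    (integrable_reward hc β hR (arm t (publicPart h)) _)
    (integrable_const (v (arm t (publicPart h)))) (fun a => hv _ a)
  simpa using this

include harm in
lemma measurable_value_arm (t : ℕ) :
    Measurable (fun h : Fin t → Round K E => v (arm t (publicPart h))) :=
  (measurable_of_finite v).comp ((harm t).comp measurable_publicPart)

include harm in
lemma integrable_value_arm (t : ℕ) (μ : Measure (Fin t → Round K E)) [IsFiniteMeasure μ] :
    Integrable (fun h : Fin t → Round K E => v (arm t (publicPart h))) μ :=
  Integrable.of_bound (measurable_value_arm harm t).aestronglyMeasurable (∑ i, |v i|)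
    (Filter.Eventually.of_forall fun _ => Finset.single_le_sum (f := fun i => |v i|)
      (fun _ _ => abs_nonneg _) (Finset.mem_univ _))

include hM hR hc hvx in
/-- The gain in the expected utility of a round from a deviation. -/
lemma integral_stageReward_deviate {t : ℕ} (ht : τ ≤ t) :
    ∫ h, stageReward harm (deviate S τ hB x) β c t h ∂(historyLaw P M (deviate S τ hB x) t) -
      ∫ h, stageReward harm S β c t h ∂(historyLaw P M S t) =
    ∫ h in past ht ⁻¹' B, v (arm t (publicPart h)) ∂(historyLaw P M (deviate S τ hB x) t) -
      ∫ h in past ht ⁻¹' B, stageReward harm S β c t h ∂(historyLaw P M S t) := by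
  have hC : MeasurableSet (past ht ⁻¹' B) := (measurable_past ht) hB
  rw [← integral_add_compl hC (integrable_stageReward harm (deviate S τ hB x) hc β hR t _),
    ← integral_add_compl hC (integrable_stageReward harm S hc β hR t _)]
  have h1 : ∫ h in past ht ⁻¹' B, stageReward harm (deviate S τ hB x) β c t h
      ∂(historyLaw P M (deviate S τ hB x) t) =
      ∫ h in past ht ⁻¹' B, v (arm t (publicPart h))
        ∂(historyLaw P M (deviate S τ hB x) t) := by
    refine setIntegral_congr_fun hC fun h hh => ?_
    unfold stageReward
    rw [effortKernel_deviate_of_mem harm S hB x ht hh, integral_dirac, hvx]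
  have h2 : ∫ h in (past ht ⁻¹' B)ᶜ, stageReward harm (deviate S τ hB x) β c t h
      ∂(historyLaw P M (deviate S τ hB x) t) =
      ∫ h in (past ht ⁻¹' B)ᶜ, stageReward harm S β c t h ∂(historyLaw P M S t) := by
    rw [← restrict_deviate_eq harm P hM S hB x ht]
    refine setIntegral_congr_fun hC.compl fun h hh => ?_
    unfold stageReward
    rw [effortKernel_deviate_of_notMem harm S hB x ht hh]
  rw [h1, h2]
  ring

/-- The history that agrees with `h` in the first `τ` rounds and is `r` afterwards. -/
def padHistory {α : Type*} (t : ℕ) (r : α) (h : Fin τ → α) : Fin t → α :=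
  fun j => if hj : (j : ℕ) < τ then h ⟨j, hj⟩ else r

lemma measurable_padHistory {α : Type*} [MeasurableSpace α] (t : ℕ) (r : α) :
    Measurable (padHistory t r : (Fin τ → α) → Fin t → α) := by
  refine measurable_pi_iff.2 fun j => ?_
  unfold padHistory
  split_ifs
  · exact measurable_pi_apply _
  · exact measurable_const

include harm in
/-- As long as the contracts do not depend on the rounds after the first `τ`, their law is not
changed by the deviation. -/
lemma setIntegral_value_deviate [NeZero K] {t : ℕ} (ht : τ ≤ t)
    (hinf : ∀ h h' : Fin t → Obs K, (∀ j : Fin t, (j : ℕ) < τ → h j = h' j) →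
      arm t h = arm t h') :
    ∫ h in past ht ⁻¹' B, v (arm t (publicPart h)) ∂(historyLaw P M (deviate S τ hB x) t) =
      ∫ h in past ht ⁻¹' B, v (arm t (publicPart h)) ∂(historyLaw P M S t) := by
  have hC : MeasurableSet (past ht ⁻¹' B) := (measurable_past ht) hB
  -- An arbitrary filler: inside the window the contract is a function of the first `τ` rounds,
  -- whose law is common to both strategies.
  set r : Round K E := ((0, x 0), 0)
  set g : (Fin τ → Round K E) → ℝ :=
    B.indicator fun h => v (arm t (publicPart (padHistory t r h))) with hg
  have hgm : Measurable g :=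
    ((measurable_value_arm harm t).comp (measurable_padHistory t r)).indicator hB
  have key : ∀ μ : Measure (Fin t → Round K E),
      ∫ h in past ht ⁻¹' B, v (arm t (publicPart h)) ∂μ = ∫ h, g (past ht h) ∂μ := by
    intro μ
    rw [← integral_indicator hC]
    refine integral_congr_ae (Filter.Eventually.of_forall fun h => ?_)
    by_cases hh : past ht h ∈ B
    · simp only [hg]
      rw [Set.indicator_of_mem (by exact hh), Set.indicator_of_mem hh]
      congr 1
      refine hinf _ _ fun j hj => ?_
      simp [publicPart, padHistory, hj, past]
    · simp only [hg]
      rw [Set.indicator_of_notMem (by exact hh), Set.indicator_of_notMem hh]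
  rw [key, key, integral_past P M _ ht hgm, integral_past P M _ ht hgm,
    historyLaw_deviate P S hB x le_rfl]

end Deviation

/-! ### What an optimal agent can forgo in a round -/

section Optimality

variable {K : ℕ} [NeZero K] {E : ℝ} {arm : (t : ℕ) → (Fin t → Obs K) → Fin K}
  (harm : ∀ t, Measurable (arm t)) (P : Kernel (Icc (0 : ℝ) E) I) [IsMarkovKernel P]
  {M : Mechanism K} (hM : ∀ t, M.kernel t = Kernel.deterministic (arm t) (harm t))
  (S : Strategy K E) (x : Fin K → Icc (0 : ℝ) E)
  {c : ℝ → ℝ} (hc : Measurable (fun a : Icc (0 : ℝ) E => c a)) (β : Fin K → ℝ)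
  {R : ℝ} (hR : ∀ i, ∀ a : Icc (0 : ℝ) E, |β i * a - c a| ≤ R)
  {v : Fin K → ℝ} (hvx : ∀ i, v i = β i * x i - c (x i))
  (hv : ∀ i, ∀ a : Icc (0 : ℝ) E, β i * a - c a ≤ v i)
  (hP : ∀ a : Icc (0 : ℝ) E, ∫ y, (y : ℝ) ∂(P a) = (a : ℝ))
  {C : ℝ} (hC : ∀ a : Icc (0 : ℝ) E, |c a| ≤ C)
  (hv0 : ∀ i, 0 ≤ v i) (hv1 : ∀ i, v i ≤ 1)

include hM hc hR hvx hv hP hC hv0 hv1 in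
/-- An optimal agent forgoes in a round, conditionally on the history, no more than the
discounted utility of the rounds whose contracts may depend on it. -/
lemma ae_loss_le {γ : ℝ} (hγ : 0 < γ) {T : ℕ} (hopt : IsOptimalStrategy β c P γ T M S)
    {τ m : ℕ} (hτ : τ < T) (hm : τ < m)
    (hinf : ∀ t, τ < t → t < T → t < m → ∀ h h' : Fin t → Obs K,
      (∀ j : Fin t, (j : ℕ) < τ → h j = h' j) → arm t h = arm t h') :
    ∀ᵐ h ∂(historyLaw P M S τ), v (arm τ (publicPart h)) - stageReward harm S β c τ h ≤
      (∑ t ∈ Finset.Ico m T, γ ^ (t + 1)) / γ ^ (τ + 1) := by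
  -- The almost sure bound follows from its integrals over all events `B`, and each `B` is tested by
  -- a deviation on `B`.
  refine ae_le_of_forall_setIntegral_le
    ((integrable_value_arm harm τ _).sub (integrable_stageReward harm S hc β hR τ _))
    (integrable_const _) fun B hB _ => ?_
  rw [setIntegral_const, smul_eq_mul]
  -- The deviation stays myopic for ever. Returning to `S` after one round would not do, since `S`
  -- may react to the altered efforts and outputs.
  have hU := hopt (deviate S τ hB x)
  rw [agentUtility_eq_sum harm P hM _ hc β hP hC, agentUtility_eq_sum harm P hM _ hc β hP hC,
    ← sub_nonpos, ← Finset.sum_sub_distrib] at hU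
  simp_rw [← mul_sub] at hU
  set L := ∫ h in B, (v (arm τ (publicPart h)) - stageReward harm S β c τ h)
    ∂(historyLaw P M S τ) with hL
  set p := (historyLaw P M S τ).real B with hp
  -- Gain of the deviation by round: none before `τ`, exactly the forgone utility `L` at `τ`,
  -- nonnegative while the contracts are unaffected, and at least `- p` from `m` on because values
  -- lie in `[0, 1]`.
  have hbound : ∀ t ∈ Finset.range T, γ ^ (t + 1) * ((if t = τ then L else 0) -
      if m ≤ t then p else 0) ≤ γ ^ (t + 1) *
      (∫ h, stageReward harm (deviate S τ hB x) β c t h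
          ∂(historyLaw P M (deviate S τ hB x) t) -
        ∫ h, stageReward harm S β c t h ∂(historyLaw P M S t)) := by
    intro t htT
    refine mul_le_mul_of_nonneg_left ?_ (by positivity)
    rcases lt_or_ge t τ with hlt | hge
    · rw [if_neg (by omega), if_neg (by omega), historyLaw_deviate P S hB x hlt.le]
      have : stageReward harm (deviate S τ hB x) β c t = stageReward harm S β c t := by
        funext h
        unfold stageReward effortKernel
        rw [Kernel.comap_apply, Kernel.comap_apply, deviate_kernel_of_lt S hB x hlt]
      rw [this]
      simp
    · rw [integral_stageReward_deviate harm P hM S hB x hc β hR hvx hge]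
      have hCm : MeasurableSet (past hge ⁻¹' B) := (measurable_past hge) hB
      have hle : ∫ h in past hge ⁻¹' B, stageReward harm S β c t h ∂(historyLaw P M S t) ≤
          ∫ h in past hge ⁻¹' B, v (arm t (publicPart h)) ∂(historyLaw P M S t) :=
        integral_mono (integrable_stageReward harm S hc β hR t _) (integrable_value_arm harm t _)
          fun h => stageReward_le harm S hc β hR hv t h
      by_cases hmt : m ≤ t
      · rw [if_neg (by omega), if_pos hmt]
        have h1 : 0 ≤ ∫ h in past hge ⁻¹' B, v (arm t (publicPart h))
            ∂(historyLaw P M (deviate S τ hB x) t) := integral_nonneg fun h => hv0 _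
        have h2 : ∫ h in past hge ⁻¹' B, v (arm t (publicPart h)) ∂(historyLaw P M S t) ≤ p := by
          have h3 := integral_mono (μ := (historyLaw P M S t).restrict (past hge ⁻¹' B))
            (integrable_value_arm (v := v) harm t _) (integrable_const (1 : ℝ)) fun h => hv1 _
          refine h3.trans (le_of_eq ?_)
          rw [setIntegral_const, smul_eq_mul, mul_one, hp,
            ← map_past_historyLaw P M S hge, map_measureReal_apply (measurable_past hge) hB]
        linarith
      · rw [if_neg hmt]
        rcases hge.eq_or_lt with rfl | hlt
        · rw [if_pos rfl, sub_zero, hL]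
          rw [integral_sub (integrable_value_arm harm τ _)
            (integrable_stageReward harm S hc β hR τ _), historyLaw_deviate P S hB x le_rfl]
          exact le_rfl
        · rw [if_neg (by omega), setIntegral_value_deviate harm P S hB x hge
            (hinf t hlt (Finset.mem_range.1 htT) (by omega))]
          linarith
  have hsum := (Finset.sum_le_sum hbound).trans hU
  simp_rw [mul_sub, Finset.sum_sub_distrib, mul_ite, mul_zero] at hsum
  rw [Finset.sum_ite_eq' , if_pos (Finset.mem_range.2 hτ), ← Finset.sum_filter,
    ← Finset.sum_mul] at hsum
  have hIco : (Finset.range T).filter (fun t => m ≤ t) = Finset.Ico m T := by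
    ext t
    simp [and_comm]
  rw [hIco] at hsum
  have hγτ : 0 < γ ^ (τ + 1) := by positivity
  have : L = γ ^ (τ + 1) * L / γ ^ (τ + 1) := by field_simp
  change L ≤ _
  rw [this, mul_div_assoc', div_le_div_iff_of_pos_right hγτ]
  linarith

end Optimality

/-! ### Concentration of the outputs -/

section Concentration

variable {K : ℕ} {E : ℝ} {arm : (t : ℕ) → (Fin t → Obs K) → Fin K}
  (harm : ∀ t, Measurable (arm t)) (P : Kernel (Icc (0 : ℝ) E) I) [IsMarkovKernel P]
  {M : Mechanism K} (hM : ∀ t, M.kernel t = Kernel.deterministic (arm t) (harm t))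
  (S : Strategy K E)

/-- Jensen's inequality for the quadratic loss. A randomized effort is controlled only through its
conditional mean, which is all that the expected output depends on. -/
lemma lam_mul_sq_meanEffort_sub_le {c : ℝ → ℝ} (hc : Measurable (fun a : Icc (0 : ℝ) E => c a))
    {β : Fin K → ℝ} {R : ℝ} (hR : ∀ i, ∀ a : Icc (0 : ℝ) E, |β i * a - c a| ≤ R)
    {lam : ℝ} (hlam : 0 < lam) {v x : Fin K → ℝ}
    (hv : ∀ i, ∀ a : Icc (0 : ℝ) E, β i * a - c a + lam / 2 * ((a : ℝ) - x i) ^ 2 ≤ v i)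
    (t : ℕ) (h : Fin t → Round K E) :
    lam / 2 * (meanEffort harm S t h - x (arm t (publicPart h))) ^ 2 ≤
      v (arm t (publicPart h)) - stageReward harm S β c t h := by
  set i := arm t (publicPart h)
  set d := meanEffort harm S t h - x i with hd
  have hint := integrable_effort (effortKernel harm S t h)
  have hrew := integrable_reward hc β hR i (effortKernel harm S t h)
  have hlin : Integrable (fun a : Icc (0 : ℝ) E => lam * d * (a : ℝ))
      (effortKernel harm S t h) := hint.const_mul _
  -- The square is replaced by its tangent at the mean, `(a - x)² ≥ 2 d (a - x) - d²`, so that only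
  -- a linear function of the effort is integrated.
  have h1 := integral_mono (μ := effortKernel harm S t h)
    (hrew.add (hlin.sub (integrable_const (lam * d * x i + lam / 2 * d ^ 2))))
    (integrable_const (v i)) (fun a => by
      have := hv i a
      simp only [Pi.add_apply, Pi.sub_apply]
      nlinarith [mul_nonneg hlam.le (sq_nonneg ((a : ℝ) - x i - d))])
  rw [integral_add' hrew (hlin.sub (integrable_const _)), integral_sub' hlin (integrable_const _),
    integral_const_mul, integral_const, integral_const] at h1
  simp only [probReal_univ, smul_eq_mul, one_mul] at h1
  have h2 : ∫ a, (a : ℝ) ∂(effortKernel harm S t h) = d + x i := by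
    rw [hd, meanEffort]; ring
  rw [h2] at h1
  change ∫ a, (β i * (a : ℝ) - c a) ∂(effortKernel harm S t h) + _ ≤ _ at h1
  change _ ≤ v i - ∫ a, (β i * (a : ℝ) - c a) ∂(effortKernel harm S t h)
  linarith

/-- Hoeffding's lemma for a variable in `[0, 1]` whose mean is only approximately known. -/
lemma lintegral_exp_le_one {Ω : Type*} [MeasurableSpace Ω] {μ : Measure Ω} [IsProbabilityMeasure μ]
    {Y : Ω → ℝ} (hY : Measurable Y) (hY01 : ∀ ω, Y ω ∈ Icc (0 : ℝ) 1) {x ε : ℝ}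
    (hx : |∫ ω, Y ω ∂μ - x| ≤ ε) (θ : ℝ) :
    ∫⁻ ω, ENNReal.ofReal (Real.exp (θ * (Y ω - x) - (θ ^ 2 / 8 + |θ| * ε))) ∂μ ≤ 1 := by
  have hsub := hasSubgaussianMGF_of_mem_Icc (μ := μ) (a := 0) (b := 1) hY.aemeasurable
    (Filter.Eventually.of_forall hY01)
  set m := ∫ ω, Y ω ∂μ with hm
  set q := θ ^ 2 / 8 + |θ| * ε with hq
  have h1 : ∀ ω, Real.exp (θ * (Y ω - x) - q) =
      Real.exp (θ * (m - x) - q) * Real.exp (θ * (Y ω - m)) := by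
    intro ω
    rw [← Real.exp_add]
    congr 1
    ring
  have hint : Integrable (fun ω => Real.exp (θ * (Y ω - x) - q)) μ := by
    simp_rw [h1]
    exact (hsub.integrable_exp_mul θ).const_mul _
  rw [← ofReal_integral_eq_lintegral_ofReal hint
    (Filter.Eventually.of_forall fun ω => (Real.exp_pos _).le)]
  refine ENNReal.ofReal_le_one.2 ?_
  simp_rw [h1]
  rw [integral_const_mul]
  have h2 := hsub.mgf_le θ
  have h3 : ∫ ω, Real.exp (θ * (Y ω - m)) ∂μ ≤ Real.exp (θ ^ 2 / 8) := by
    refine h2.trans (le_of_eq ?_)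
    congr 1
    norm_num
    ring
  calc Real.exp (θ * (m - x) - q) * ∫ ω, Real.exp (θ * (Y ω - m)) ∂μ
      ≤ Real.exp (θ * (m - x) - q) * Real.exp (θ ^ 2 / 8) := by gcongr
    _ = Real.exp (θ * (m - x) - |θ| * ε) := by
        rw [← Real.exp_add]; congr 1; rw [hq]; ring
    _ ≤ 1 := by
        refine Real.exp_le_one_iff.2 ?_
        have h4 : θ * (m - x) ≤ |θ| * |m - x| := by rw [← abs_mul]; exact le_abs_self _
        have h5 : |θ| * |m - x| ≤ |θ| * ε := by gcongr
        linarith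

include hM in
lemma integral_output_roundKernel (hP : ∀ a : Icc (0 : ℝ) E, ∫ y, (y : ℝ) ∂(P a) = (a : ℝ))
    (t : ℕ) (h : Fin t → Round K E) :
    ∫ r, (r.2 : ℝ) ∂(roundKernel P M S t h) = meanEffort harm S t h := by
  rw [integral_roundKernel harm P hM S t h (g := fun r => (r.2 : ℝ)) (by fun_prop) (C := 1)
    (fun r => by rw [abs_of_nonneg r.2.2.1]; exact r.2.2.2)]
  simp only [hP]
  rfl

/-- The number of rounds of a history in which contract `i` was posted. -/
def historyCount {t : ℕ} (h : Fin t → Round K E) (i : Fin K) : ℕ :=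
  ∑ j, if (h j).1.1 = i then 1 else 0

/-- The sum of the deviations from `x` of the outputs under contract `i`. -/
noncomputable def historyDeviation {t : ℕ} (h : Fin t → Round K E) (i : Fin K) (x : ℝ) : ℝ :=
  ∑ j, if (h j).1.1 = i then ((h j).2 : ℝ) - x else 0

include hM in
-- Markov's inequality for a product of Hoeffding factors. The number of pulls is random and depends
-- on past outputs; fixing it to `n` inside the event makes the compensator deterministic.
lemma measure_historyDeviation_ge_le
    (hP : ∀ a : Icc (0 : ℝ) E, ∫ y, (y : ℝ) ∂(P a) = (a : ℝ)) {x : Fin K → ℝ} {ε : ℝ} {T : ℕ}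
    (hx : ∀ t < T, ∀ᵐ h ∂(historyLaw P M S t),
      |meanEffort harm S t h - x (arm t (publicPart h))| ≤ ε)
    {t : ℕ} (ht : t ≤ T) (i : Fin K) (n : ℕ) (θ ρ : ℝ) :
    historyLaw P M S t {h | historyCount h i = n ∧ ρ ≤ θ * historyDeviation h i (x i)} ≤
      ENNReal.ofReal (Real.exp (n * (θ ^ 2 / 8 + |θ| * ε) - ρ)) := by
  set q := θ ^ 2 / 8 + |θ| * ε with hq
  -- Rounds with another contract contribute the factor 1.
  set w : Round K E → ENNReal := fun r =>
    ENNReal.ofReal (Real.exp (if r.1.1 = i then θ * ((r.2 : ℝ) - x i) - q else 0)) with hw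
  have hwm : Measurable w := by
    refine ENNReal.measurable_ofReal.comp (Real.measurable_exp.comp ?_)
    refine Measurable.ite ?_ (by fun_prop) measurable_const
    exact (measurable_fst.comp measurable_fst) (MeasurableSet.singleton i)
  have h1 : ∀ t < T, ∀ᵐ h ∂(historyLaw P M S t), ∫⁻ r, w r ∂(roundKernel P M S t h) ≤ 1 := by
    intro t ht
    filter_upwards [hx t ht] with h hh
    by_cases hi : arm t (publicPart h) = i
    · have h2 : ∫⁻ r, w r ∂(roundKernel P M S t h) =
          ∫⁻ r, ENNReal.ofReal (Real.exp (θ * ((r.2 : ℝ) - x i) - q))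
            ∂(roundKernel P M S t h) := by
        refine lintegral_congr_ae ?_
        filter_upwards [ae_roundKernel_fst harm P hM S t h] with r hr
        simp only [hw]
        rw [if_pos (hr.trans hi)]
      rw [h2]
      refine lintegral_exp_le_one (by fun_prop) (fun r => r.2.2) ?_ θ
      rw [integral_output_roundKernel harm P hM S hP, ← hi]
      exact hh
    · have h2 : ∫⁻ r, w r ∂(roundKernel P M S t h) = ∫⁻ _r, 1 ∂(roundKernel P M S t h) := by
        refine lintegral_congr_ae ?_
        filter_upwards [ae_roundKernel_fst harm P hM S t h] with r hr
        simp only [hw]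
        rw [if_neg (by rw [hr]; exact hi)]
        simp
      rw [h2]
      simp
  have h3 := lintegral_prod_le_one P M S hwm h1 ht
  have h4 : ∀ h : Fin t → Round K E, ∏ j, w (h j) =
      ENNReal.ofReal (Real.exp (θ * historyDeviation h i (x i) - historyCount h i * q)) := by
    intro h
    simp only [hw]
    rw [← ENNReal.ofReal_prod_of_nonneg fun j _ => (Real.exp_pos _).le, ← Real.exp_sum]
    congr 2
    unfold historyDeviation historyCount
    push_cast
    rw [Finset.mul_sum, Finset.sum_mul, ← Finset.sum_sub_distrib]
    refine Finset.sum_congr rfl fun j _ => ?_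
    split_ifs <;> ring
  have hpm : Measurable fun h : Fin t → Round K E => ∏ j, w (h j) :=
    Finset.measurable_fun_prod _ fun j _ => hwm.comp (measurable_pi_apply j)
  have h5 := mul_meas_ge_le_lintegral (μ := historyLaw P M S t) hpm
    (ENNReal.ofReal (Real.exp (ρ - n * q)))
  have h6 : historyLaw P M S t {h | historyCount h i = n ∧ ρ ≤ θ * historyDeviation h i (x i)} ≤
      historyLaw P M S t {h | ENNReal.ofReal (Real.exp (ρ - n * q)) ≤ ∏ j, w (h j)} := by
    refine measure_mono fun h hh => ?_
    obtain ⟨hn, hρ⟩ := hh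
    simp only [mem_ofPred_eq, h4]
    refine ENNReal.ofReal_le_ofReal (Real.exp_le_exp.2 ?_)
    rw [hn]
    linarith
  have h7 := h5.trans h3
  have hpos := Real.exp_pos (ρ - n * q)
  have h8 : historyLaw P M S t {h | ENNReal.ofReal (Real.exp (ρ - n * q)) ≤ ∏ j, w (h j)} ≤
      (ENNReal.ofReal (Real.exp (ρ - n * q)))⁻¹ := by
    rw [← one_div, ENNReal.le_div_iff_mul_le (Or.inl (ENNReal.ofReal_pos.2 hpos).ne')
      (Or.inl ENNReal.ofReal_ne_top), mul_comm]
    exact h7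
  refine h6.trans (h8.trans (le_of_eq ?_))
  rw [← ENNReal.ofReal_inv_of_pos hpos, ← Real.exp_neg]
  congr 2
  ring

/-- The observations of a history of length `T`, continued arbitrarily. -/
def observations [NeZero K] {T : ℕ} (h : Fin T → Round K E) : ℕ → Obs K :=
  fun j => if hj : j < T then ((h ⟨j, hj⟩).1.1, (h ⟨j, hj⟩).2) else (0, 0)

lemma initialSegment_observations [NeZero K] {t T : ℕ} (ht : t ≤ T) (h : Fin T → Round K E) :
    initialSegment (observations h) t = publicPart (past ht h) := by
  funext j
  have : (j : ℕ) < T := j.2.trans_le ht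
  simp only [initialSegment, observations, this, dif_pos]
  rfl

lemma pullCount_observations [NeZero K] {t T : ℕ} (ht : t ≤ T) (h : Fin T → Round K E)
    (i : Fin K) : pullCount (observations h) i t = historyCount (past ht h) i := by
  unfold pullCount historyCount
  rw [Finset.card_filter, Finset.sum_range]
  refine Finset.sum_congr rfl fun j _ => ?_
  have : (j : ℕ) < T := j.2.trans_le ht
  simp only [observations, this, dif_pos]
  rfl

lemma sum_observations [NeZero K] {t T : ℕ} (ht : t ≤ T) (h : Fin T → Round K E)
    (i : Fin K) (x : ℝ) :
    ∑ j ∈ Finset.range t with (observations h j).1 = i, (((observations h j).2 : ℝ) - x) =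
      historyDeviation (past ht h) i x := by
  unfold historyDeviation
  rw [Finset.sum_filter, Finset.sum_range]
  refine Finset.sum_congr rfl fun j _ => ?_
  have : (j : ℕ) < T := j.2.trans_le ht
  simp only [observations, this, dif_pos]
  rfl

/-- The exponent in the tail bound for `n` pulls. -/
lemma tail_exponent_le {T n : ℕ} (hT : 2 ≤ T) (hn : 0 < n) (hnT : n ≤ T) {ε : ℝ}
    (hε : ε ≤ 3 / 2 / T) :
    n * ((4 * √(2 * Real.log T / n)) ^ 2 / 8 + 4 * √(2 * Real.log T / n) * ε) -
      4 * √(2 * Real.log T / n) * (n * (√(2 * Real.log T / n) + 1 / T)) ≤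
      3 - 4 * Real.log T := by
  have hn0 : (0 : ℝ) < n := by exact_mod_cast hn
  have hT0 : (0 : ℝ) < T := by positivity
  have hnT' : (n : ℝ) ≤ T := by exact_mod_cast hnT
  have hlog : 0 < Real.log T := Real.log_pos (by exact_mod_cast hT)
  have hlogT : Real.log T ≤ T := Real.log_le_self hT0.le
  set r := √(2 * Real.log T / n) with hr
  have hr0 : 0 ≤ r := Real.sqrt_nonneg _
  have hsq : n * r ^ 2 = 2 * Real.log T := by
    rw [hr, Real.sq_sqrt (by positivity)]
    field_simp
  -- `(n r)² = 2 n log T ≤ 2 T²`, and `√2 ≤ 3/2`.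
  have h1 : n * r ≤ 3 / 2 * T := by
    refine abs_le_of_sq_le_sq' ?_ (by positivity) |>.2
    have : (n * r) ^ 2 = n * (n * r ^ 2) := by ring
    rw [this, hsq]
    nlinarith
  have h2 : n * (4 * r * ε) ≤ 4 * (n * r) * (3 / 2 / T) := by
    have : 0 ≤ 4 * (n * r) := by positivity
    nlinarith [mul_le_mul_of_nonneg_left hε this]
  -- The bias `ε` may exceed the perturbation `1/T` by up to half of it. The excess adds at most 3
  -- to the exponent, which is the source of the factor `exp 3`.
  have h3 : 4 * (n * r) * (3 / 2 / T) - 4 * (n * r) * (1 / T) = 2 * (n * r / T) := by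
    field_simp
    ring
  have h4 : n * r / T ≤ 3 / 2 := by rwa [div_le_iff₀ hT0]
  have h5 : n * ((4 * r) ^ 2 / 8 + 4 * r * ε) - 4 * r * (n * (r + 1 / T)) =
      n * (4 * r * ε) - 4 * (n * r) * (1 / T) - 2 * (n * r ^ 2) := by ring
  rw [h5, hsq]
  linarith

include hM in
/-- The outputs are concentrated with probability `1 - O(1/T)`. -/
lemma measure_not_isConcentrated_le [NeZero K]
    (hP : ∀ a : Icc (0 : ℝ) E, ∫ y, (y : ℝ) ∂(P a) = (a : ℝ)) {x : Fin K → ℝ} {ε : ℝ} {T : ℕ}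
    (hx : ∀ t < T, ∀ᵐ h ∂(historyLaw P M S t),
      |meanEffort harm S t h - x (arm t (publicPart h))| ≤ ε)
    (hT : 2 ≤ T) (hKT : K ≤ T) (hε : ε ≤ 3 / 2 / T) :
    historyLaw P M S T {h | ¬ IsConcentrated T (1 / T) x (observations h)} ≤
      ENNReal.ofReal (4 * Real.exp 3 / T) := by
  have hT0 : (0 : ℝ) < T := by positivity
  set r : ℕ → ℝ := fun n => √(2 * Real.log T / n) with hr
  have hr0 : ∀ n, 0 ≤ r n := fun n => Real.sqrt_nonneg _
  -- The union runs over the time `t`, the arm, the number `n` of pulls and the sign of the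
  -- deviation. The choice `θ = ± 4 r n` optimizes the Hoeffding exponent and leaves a probability
  -- of order `T⁻⁴`.
  have hone : ∀ p ∈ (Finset.range (T + 1)) ×ˢ (Finset.univ : Finset (Fin K)) ×ˢ
      (Finset.Icc 1 T) ×ˢ ({1, -1} : Finset ℝ),
      historyLaw P M S T {h | ∃ ht : p.1 ≤ T, historyCount (past ht h) p.2.1 = p.2.2.1 ∧
        4 * r p.2.2.1 * (p.2.2.1 * (r p.2.2.1 + 1 / T)) ≤
          p.2.2.2 * (4 * r p.2.2.1) * historyDeviation (past ht h) p.2.1 (x p.2.1)} ≤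
      ENNReal.ofReal (Real.exp 3 / T ^ 4) := by
    rintro ⟨t, i, n, s⟩ hp
    simp only [Finset.mem_product, Finset.mem_range, Finset.mem_univ, true_and, Finset.mem_Icc,
      Finset.mem_insert, Finset.mem_singleton] at hp
    obtain ⟨ht, ⟨hn1, hnT⟩, hs⟩ := hp
    have ht' : t ≤ T := by omega
    have h1 := measure_historyDeviation_ge_le harm P hM S hP hx ht' i n (s * (4 * r n))
      (4 * r n * (n * (r n + 1 / T)))
    rw [← map_past_historyLaw P M S ht'] at h1
    have h2 := (Measure.le_map_apply (measurable_past ht').aemeasurable _).trans h1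
    refine (measure_mono ?_).trans (h2.trans ?_)
    · rintro h ⟨_, hh⟩
      exact hh
    · refine ENNReal.ofReal_le_ofReal ?_
      have hs2 : s ^ 2 = 1 := by rcases hs with rfl | rfl <;> norm_num
      have hs1 : |s| = 1 := by rcases hs with rfl | rfl <;> norm_num
      have h3 := tail_exponent_le hT (by omega : 0 < n) hnT hε
      rw [abs_mul, hs1, one_mul, mul_pow, hs2, one_mul,
        abs_of_nonneg (by have := hr0 n; positivity)]
      refine (Real.exp_le_exp.2 h3).trans (le_of_eq ?_)
      rw [Real.exp_sub, mul_comm 4, ← Real.rpow_def_of_pos hT0]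
      norm_cast
  have hcover : {h : Fin T → Round K E | ¬ IsConcentrated T (1 / T) x (observations h)} ⊆
      ⋃ p ∈ (Finset.range (T + 1)) ×ˢ (Finset.univ : Finset (Fin K)) ×ˢ
      (Finset.Icc 1 T) ×ˢ ({1, -1} : Finset ℝ),
      {h | ∃ ht : p.1 ≤ T, historyCount (past ht h) p.2.1 = p.2.2.1 ∧
        4 * r p.2.2.1 * (p.2.2.1 * (r p.2.2.1 + 1 / T)) ≤
          p.2.2.2 * (4 * r p.2.2.1) * historyDeviation (past ht h) p.2.1 (x p.2.1)} := by
    intro h hh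
    simp only [mem_ofPred_eq, IsConcentrated] at hh
    push Not at hh
    obtain ⟨t, ht, i, hn, hlt⟩ := hh
    rw [sum_observations ht] at hlt
    have hle := pullCount_le (observations h) i t
    rw [pullCount_observations ht] at hlt hn hle
    set n := historyCount (past ht h) i
    have hgoal : ∀ s : ℝ, s ∈ ({1, -1} : Finset ℝ) →
        n * (r n + 1 / T) ≤ s * historyDeviation (past ht h) i (x i) →
        h ∈ ⋃ p ∈ (Finset.range (T + 1)) ×ˢ (Finset.univ : Finset (Fin K)) ×ˢ
      (Finset.Icc 1 T) ×ˢ ({1, -1} : Finset ℝ),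
      {h | ∃ ht : p.1 ≤ T, historyCount (past ht h) p.2.1 = p.2.2.1 ∧
        4 * r p.2.2.1 * (p.2.2.1 * (r p.2.2.1 + 1 / T)) ≤
          p.2.2.2 * (4 * r p.2.2.1) * historyDeviation (past ht h) p.2.1 (x p.2.1)} := by
      intro s hs hdev
      refine mem_biUnion (x := (t, i, n, s)) ?_ ⟨ht, rfl, ?_⟩
      · simp only [Finset.mem_coe, Finset.mem_product, Finset.mem_range, Finset.mem_univ,
          true_and, Finset.mem_Icc]
        exact ⟨by omega, ⟨by omega, by omega⟩, hs⟩
      · have h4 : 0 ≤ 4 * r n := by have := hr0 n; positivity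
        have := mul_le_mul_of_nonneg_left hdev h4
        simp only
        linarith
    rcases lt_abs.1 hlt with h1 | h1
    · exact hgoal 1 (by simp) (by rw [one_mul]; exact h1.le)
    · exact hgoal (-1) (by simp) (by rw [neg_one_mul]; exact h1.le)
  refine (measure_mono hcover).trans ((measure_biUnion_finset_le _ _).trans ?_)
  refine (Finset.sum_le_sum hone).trans ?_
  rw [Finset.sum_const, nsmul_eq_mul, ← ENNReal.ofReal_natCast,
    ← ENNReal.ofReal_mul (Nat.cast_nonneg _)]
  refine ENNReal.ofReal_le_ofReal ?_
  have hcard : ((Finset.range (T + 1)) ×ˢ (Finset.univ : Finset (Fin K)) ×ˢ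
      (Finset.Icc 1 T) ×ˢ ({1, -1} : Finset ℝ)).card = (T + 1) * (K * (T * 2)) := by
    rw [Finset.card_product, Finset.card_product, Finset.card_product, Finset.card_range,
      Finset.card_univ, Fintype.card_fin, Nat.card_Icc, Finset.card_pair (by norm_num)]
    simp
  rw [hcard]
  -- Only here is `K ≤ T` used; more arms than rounds are treated separately.
  have hle : (T + 1) * (K * (T * 2)) ≤ 4 * T ^ 3 := by
    calc (T + 1) * (K * (T * 2)) ≤ (2 * T) * (T * (T * 2)) := by gcongr; omega
      _ = 4 * T ^ 3 := by ring
  have hle' : (((T + 1) * (K * (T * 2)) : ℕ) : ℝ) ≤ 4 * (T : ℝ) ^ 3 := by exact_mod_cast hle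
  calc (((T + 1) * (K * (T * 2)) : ℕ) : ℝ) * (Real.exp 3 / T ^ 4)
      ≤ 4 * (T : ℝ) ^ 3 * (Real.exp 3 / T ^ 4) := by gcongr
    _ = 4 * Real.exp 3 / T := by field_simp

end Concentration

/-! ### The discounted horizon and the delay -/

lemma discountedHorizon_eq (γ : ℝ) (T : ℕ) :
    discountedHorizon γ T = ∑ t ∈ Finset.range T, γ ^ (t + 1) := by
  unfold discountedHorizon
  rw [Finset.range_eq_Ico, Finset.sum_Ico_add' (fun t => γ ^ t) 0 T 1]
  rfl

section Discount

variable {γ lam : ℝ} {T : ℕ}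

lemma le_discountedHorizon (hγ : 0 < γ) (hT : 1 ≤ T) : γ ≤ discountedHorizon γ T := by
  rw [discountedHorizon_eq]
  have := Finset.single_le_sum (f := fun t => γ ^ (t + 1)) (fun t _ => by positivity)
    (Finset.mem_range.2 (show 0 < T by omega))
  simpa using this

lemma sum_Ico_pow_le (hγ : 0 < γ) (m T : ℕ) :
    ∑ t ∈ Finset.Ico m T, γ ^ (t + 1) ≤ γ ^ m * discountedHorizon γ T := by
  rw [discountedHorizon_eq, Finset.sum_Ico_eq_sum_range, Finset.mul_sum]
  calc ∑ k ∈ Finset.range (T - m), γ ^ (m + k + 1)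
      = ∑ k ∈ Finset.range (T - m), γ ^ m * γ ^ (k + 1) :=
        Finset.sum_congr rfl fun k _ => by rw [← pow_add, add_assoc]
    _ ≤ _ := Finset.sum_le_sum_of_subset_of_nonneg
        (Finset.range_subset_range.2 (Nat.sub_le T m)) fun k _ _ => by positivity

lemma delay_nonneg (hγ : 0 < γ) (hγ1 : γ < 1) (hlam : 0 < lam) (hT : 2 ≤ T)
    (h : 2 * lam ≤ T * discountedHorizon γ T) : 0 ≤ delay γ lam T := by
  have hT2 : (2 : ℝ) ≤ T := by exact_mod_cast hT
  refine div_nonneg (Real.log_nonneg ?_) (Real.log_nonneg ?_)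
  · rw [le_div_iff₀ hlam]
    nlinarith
  · rw [le_div_iff₀ hγ]
    linarith

/-- This equation is what defines the delay: discounting by `D` rounds scales the total value `T_γ`
down to `λ / T²`. -/
lemma rpow_delay (hγ : 0 < γ) (hγ1 : γ < 1) (hlam : 0 < lam) (hT : 2 ≤ T) :
    γ ^ delay γ lam T = lam / ((T : ℝ) ^ 2 * discountedHorizon γ T) := by
  have hH := hγ.trans_le (le_discountedHorizon hγ (show 1 ≤ T by omega))
  have hlog : Real.log γ < 0 := Real.log_neg hγ hγ1
  have hT0 : (0 : ℝ) < T := by positivity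
  rw [Real.rpow_def_of_pos hγ, delay, one_div, Real.log_inv]
  have : Real.log γ * (Real.log ((T : ℝ) ^ 2 * discountedHorizon γ T / lam) / -Real.log γ) =
      Real.log (((T : ℝ) ^ 2 * discountedHorizon γ T / lam)⁻¹) := by
    rw [Real.log_inv, div_neg, mul_neg, mul_div_cancel₀ _ hlog.ne]
  rw [this, Real.exp_log (by positivity), inv_div]

/-- The influence of round `τ` starts after `τ + 2 + D`, against a weight `γ ^ (τ + 1)`. The
remaining factor `γ` is kept because the target bound is divided by `log (1 / γ)`, which is large
for small `γ`. -/
lemma influence_le (hγ : 0 < γ) (hγ1 : γ < 1) (hlam : 0 < lam) (hT : 2 ≤ T)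
    {τ m : ℕ} (hm : (τ : ℝ) + 2 + delay γ lam T ≤ m) :
    (∑ t ∈ Finset.Ico m T, γ ^ (t + 1)) / γ ^ (τ + 1) ≤ γ * lam / (T : ℝ) ^ 2 := by
  have hH := hγ.trans_le (le_discountedHorizon hγ (show 1 ≤ T by omega))
  have hT0 : (0 : ℝ) < T := by positivity
  rw [div_le_iff₀ (by positivity)]
  refine (sum_Ico_pow_le hγ m T).trans ?_
  have h1 : γ ^ m ≤ γ ^ (τ + 2) * (lam / ((T : ℝ) ^ 2 * discountedHorizon γ T)) := by
    rw [← rpow_delay hγ hγ1 hlam hT, ← Real.rpow_natCast γ m, ← Real.rpow_natCast γ (τ + 2),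
      ← Real.rpow_add hγ]
    refine Real.rpow_le_rpow_of_exponent_ge hγ hγ1.le ?_
    push_cast
    exact hm
  calc γ ^ m * discountedHorizon γ T
      ≤ γ ^ (τ + 2) * (lam / ((T : ℝ) ^ 2 * discountedHorizon γ T)) * discountedHorizon γ T := by
        gcongr
    _ = γ * lam / (T : ℝ) ^ 2 * γ ^ (τ + 1) := by
        field_simp
        ring

end Discount

/-! ### The regret in terms of the gaps -/

section Regret

variable {K : ℕ} [NeZero K] {E : ℝ} {arm : (t : ℕ) → (Fin t → Obs K) → Fin K}
  (harm : ∀ t, Measurable (arm t)) (P : Kernel (Icc (0 : ℝ) E) I) [IsMarkovKernel P]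
  {M : Mechanism K} (hM : ∀ t, M.kernel t = Kernel.deterministic (arm t) (harm t))
  (S : Strategy K E)

omit [NeZero K] in
include hM in
lemma integral_utility_ge {β : Fin K → ℝ} (hβ : ∀ i, β i ∈ Icc (0 : ℝ) 1)
    (hP : ∀ a : Icc (0 : ℝ) E, ∫ y, (y : ℝ) ∂(P a) = (a : ℝ)) {x : Fin K → ℝ}
    (hx01 : ∀ i, x i ∈ Icc (0 : ℝ) 1) {ε : ℝ} {T : ℕ} (j : Fin T)
    (hx : ∀ᵐ h ∂(historyLaw P M S j), |meanEffort harm S j h - x (arm j (publicPart h))| ≤ ε) :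
    ∫ h, (1 - β (h j).1.1) * x (h j).1.1 ∂(historyLaw P M S T) - ε ≤
      ∫ h, (1 - β (h j).1.1) * ((h j).2 : ℝ) ∂(historyLaw P M S T) := by
  have hbd : ∀ (i : Fin K) (y : ℝ), y ∈ Icc (0 : ℝ) 1 → |(1 - β i) * y| ≤ 1 := by
    intro i y hy
    have h1 := hβ i
    rw [abs_of_nonneg (mul_nonneg (by linarith [h1.2]) hy.1)]
    exact mul_le_one₀ (by linarith [h1.1]) hy.1 hy.2
  have hβm : Measurable (fun r : Round K E => 1 - β r.1.1) :=
    (measurable_of_finite fun i => 1 - β i).comp (by fun_prop : Measurable fun r : Round K E => r.1.1)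
  have hxm : Measurable (fun r : Round K E => x r.1.1) :=
    (measurable_of_finite x).comp (by fun_prop : Measurable fun r : Round K E => r.1.1)
  have hg1 : Measurable (fun r : Round K E => (1 - β r.1.1) * x r.1.1) := hβm.mul hxm
  have hg2 : Measurable (fun r : Round K E => (1 - β r.1.1) * (r.2 : ℝ)) :=
    hβm.mul (by fun_prop)
  rw [integral_round P M S j hg1 (C := 1) fun r => hbd _ _ (hx01 _),
    integral_round P M S j hg2 (C := 1) fun r => hbd _ _ r.2.2]
  have h1 : ∀ h : Fin j → Round K E,
      ∫ r, (1 - β r.1.1) * x r.1.1 ∂(roundKernel P M S j h) =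
        (1 - β (arm j (publicPart h))) * x (arm j (publicPart h)) := by
    intro h
    rw [integral_roundKernel harm P hM S j h hg1 (C := 1) fun r => hbd _ _ (hx01 _)]
    simp
  have h2 : ∀ h : Fin j → Round K E,
      ∫ r, (1 - β r.1.1) * (r.2 : ℝ) ∂(roundKernel P M S j h) =
        (1 - β (arm j (publicPart h))) * meanEffort harm S j h := by
    intro h
    rw [integral_roundKernel harm P hM S j h hg2 (C := 1) fun r => hbd _ _ r.2.2]
    simp only [integral_const_mul, hP]
    rfl
  simp_rw [h1, h2]
  have hint1 : Integrable (fun h : Fin j → Round K E =>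
      (1 - β (arm j (publicPart h))) * x (arm j (publicPart h))) (historyLaw P M S j) :=
    integrable_value_arm (v := fun i => (1 - β i) * x i) harm j _
  have hE1 : ∀ h : Fin j → Round K E, |meanEffort harm S j h| ≤ E := by
    intro h
    have := norm_integral_le_of_norm_le_const (μ := effortKernel harm S j h)
      (f := fun a : Icc (0 : ℝ) E => (a : ℝ)) (C := E)
      (Filter.Eventually.of_forall fun a => by
        rw [Real.norm_eq_abs, abs_of_nonneg a.2.1]; exact a.2.2)
    simpa [meanEffort] using this
  have hint2 : Integrable (fun h : Fin j → Round K E =>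
      (1 - β (arm j (publicPart h))) * meanEffort harm S j h) (historyLaw P M S j) := by
    refine Integrable.of_bound ((measurable_value_arm (v := fun i => 1 - β i) harm j).mul
      (measurable_meanEffort harm S j)).aestronglyMeasurable E
      (Filter.Eventually.of_forall fun h => ?_)
    have h3 := hβ (arm j (publicPart h))
    rw [Real.norm_eq_abs, abs_mul, abs_of_nonneg (by linarith [h3.2])]
    have := hE1 h
    nlinarith [abs_nonneg (meanEffort harm S j h), h3.1]
  have h4 := integral_mono_ae (hint1.sub (integrable_const ε)) hint2 (by
    filter_upwards [hx] with h hh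
    have h3 := hβ (arm j (publicPart h))
    have h5 := (abs_le.1 hh).1
    have h6 : 0 ≤ ε := (abs_nonneg _).trans hh
    simp only [Pi.sub_apply]
    nlinarith [mul_nonneg h3.1 h6,
      mul_le_mul_of_nonneg_left h5 (show 0 ≤ 1 - β (arm j (publicPart h)) by linarith [h3.2])])
  rw [integral_sub' hint1 (integrable_const ε)] at h4
  simpa using h4

omit [NeZero K] in
include hM in
-- Truthful play would lose exactly the gap in each round, and an effort error `ε` costs a further
-- `(1 - β) ε ≤ ε`.
lemma strategicRegret_le {β : Fin K → ℝ} (hβ : ∀ i, β i ∈ Icc (0 : ℝ) 1)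
    (hP : ∀ a : Icc (0 : ℝ) E, ∫ y, (y : ℝ) ∂(P a) = (a : ℝ)) {c : ℝ → ℝ}
    (hx01 : ∀ i, bestResponse E c (β i) ∈ Icc (0 : ℝ) 1) {ε : ℝ} {T : ℕ}
    (hx : ∀ t < T, ∀ᵐ h ∂(historyLaw P M S t),
      |meanEffort harm S t h - bestResponse E c (β (arm t (publicPart h)))| ≤ ε) :
    strategicRegret β c P T M S ≤
      ∫ h, ∑ j : Fin T, gap E c β (h j).1.1 ∂(historyLaw P M S T) + T * ε := by
  unfold strategicRegret
  have hfin : ∀ f : Fin K → ℝ, ∀ j : Fin T,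
      Integrable (fun h : Fin T → Round K E => f (h j).1.1) (historyLaw P M S T) := by
    intro f j
    refine Integrable.of_bound ((measurable_of_finite f).comp (by fun_prop)).aestronglyMeasurable
      (∑ i, |f i|) (Filter.Eventually.of_forall fun h =>
        Finset.single_le_sum (f := fun i => |f i|) (fun i _ => abs_nonneg _)
          (Finset.mem_univ _))
  have hout : ∀ j : Fin T, Integrable (fun h : Fin T → Round K E =>
      (1 - β (h j).1.1) * ((h j).2 : ℝ)) (historyLaw P M S T) := by
    intro j
    have hm : Measurable (fun h : Fin T → Round K E => 1 - β (h j).1.1) :=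
      (measurable_of_finite fun i => 1 - β i).comp (by fun_prop)
    refine Integrable.of_bound (hm.mul (by fun_prop)).aestronglyMeasurable 1
      (Filter.Eventually.of_forall fun h => ?_)
    have h1 := hβ (h j).1.1
    have h2 := (h j).2.2
    rw [Real.norm_eq_abs, abs_of_nonneg (mul_nonneg (by linarith [h1.2]) h2.1)]
    exact mul_le_one₀ (by linarith [h1.1]) h2.1 h2.2
  rw [integral_finsetSum _ fun j _ => hfin (gap E c β) j, integral_finsetSum _ fun j _ => hout j]
  have hterm : ∀ j : Fin T, bestUtility E c β -
      ∫ h, (1 - β (h j).1.1) * ((h j).2 : ℝ) ∂(historyLaw P M S T) ≤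
      ∫ h, gap E c β (h j).1.1 ∂(historyLaw P M S T) + ε := by
    intro j
    have h1 := integral_utility_ge harm P hM S hβ hP hx01 j (hx j j.2)
    have h2 : ∫ h, gap E c β (h j).1.1 ∂(historyLaw P M S T) = bestUtility E c β -
        ∫ h, (1 - β (h j).1.1) * bestResponse E c (β (h j).1.1) ∂(historyLaw P M S T) := by
      unfold gap truthfulUtility
      rw [integral_sub (integrable_const _) (hfin (fun i => (1 - β i) * bestResponse E c (β i)) j)]
      simp
    rw [h2]
    linarith
  have := Finset.sum_le_sum fun j (_ : j ∈ Finset.univ) => hterm j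
  rw [Finset.sum_sub_distrib, Finset.sum_add_distrib] at this
  simp only [Finset.sum_const, Finset.card_univ, Fintype.card_fin, nsmul_eq_mul] at this
  linarith

lemma integral_le_add_mul_measure {Ω : Type*} [MeasurableSpace Ω] {μ : Measure Ω}
    [IsProbabilityMeasure μ] {f : Ω → ℝ} (hf : Integrable f μ) {s : Set Ω} {A B p : ℝ}
    (hA : 0 ≤ A) (hB : 0 ≤ B) (hp : 0 ≤ p) (hs : μ s ≤ ENNReal.ofReal p)
    (hfB : ∀ ω, f ω ≤ B) (hfA : ∀ᵐ ω ∂μ, ω ∉ s → f ω ≤ A) : ∫ ω, f ω ∂μ ≤ A + B * p := by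
  -- The exceptional set need not be measurable; its measurable hull has the same measure.
  set s' := toMeasurable μ s
  have hs' : MeasurableSet s' := measurableSet_toMeasurable μ s
  have hind : Integrable (s'.indicator fun _ => B) μ := (integrable_const B).indicator hs'
  have h1 : ∫ ω, f ω ∂μ ≤ ∫ ω, (A + s'.indicator (fun _ => B) ω) ∂μ := by
    refine integral_mono_ae hf ((integrable_const A).add hind) ?_
    filter_upwards [hfA] with ω hω
    by_cases hmem : ω ∈ s'
    · rw [Set.indicator_of_mem hmem]
      linarith [hfB ω]
    · rw [Set.indicator_of_notMem hmem]
      linarith [hω fun h => hmem (subset_toMeasurable μ s h)]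
  rw [integral_add (integrable_const A) hind, integral_indicator hs', setIntegral_const,
    integral_const] at h1
  have h2 : μ.real s' ≤ p := by
    rw [Measure.real, measure_toMeasurable]
    exact ENNReal.toReal_le_of_le_ofReal hp hs
  simp only [probReal_univ, smul_eq_mul, one_mul] at h1
  nlinarith

end Regret

/-! ### The regret of delayed elimination -/

/-! ### Inequalities that absorb the delay and the effort error -/

section Arithmetic

variable {γ : ℝ}

/-- The total effort error is of order `√γ`; this compares it with `1 / log (1 / γ)`. -/
lemma sqrt_mul_log_inv_le (hγ : 0 < γ) : √γ * Real.log (1 / γ) ≤ 2 := by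
  have hs : 0 < √γ := Real.sqrt_pos.2 hγ
  have h1 : Real.log (1 / γ) = 2 * Real.log (1 / √γ) := by
    rw [one_div, one_div, Real.log_inv, Real.log_inv, Real.log_sqrt hγ.le]
    ring
  have h2 := Real.log_le_sub_one_of_pos (show 0 < 1 / √γ by positivity)
  have h3 : √γ * (1 / √γ) = 1 := by field_simp
  rw [h1]
  nlinarith

/-- The trivial bound `2 / lam` on the gaps makes up for the difference between the logarithm of
the horizon and that of `X = T T_γ / lam`. -/
lemma min_mul_log_le {lam H T X : ℝ} (hlam : 0 < lam) (hT : 2 ≤ T) (hH : 1 / 2 ≤ H)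
    (hX : X = T * H / lam) (hX2 : 2 ≤ X) :
    min 1 (2 / lam) * Real.log T ≤ 16 * Real.log X := by
  have hl2 := Real.log_two_gt_d9
  have hlX : 1 / 2 ≤ Real.log X :=
    (by linarith : (1 : ℝ) / 2 ≤ Real.log 2).trans (Real.log_le_log (by norm_num) hX2)
  have hT0 : 0 < T := by linarith
  have hlT : 0 ≤ Real.log T := Real.log_nonneg (by linarith)
  -- If `T ≤ X²` the two logarithms are comparable. Otherwise `X < √T` forces `λ = T H / X ≥ √T /
  -- 2`, and the gap bound `2 / λ ≤ 4 / √T` beats `log T ≤ 2 √T`.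
  rcases le_or_gt T (X ^ 2) with h | h
  · have h1 : Real.log T ≤ 2 * Real.log X := by
      have := Real.log_le_log hT0 h
      rwa [Real.log_pow] at this
    have h2 : min 1 (2 / lam) * Real.log T ≤ 1 * Real.log T := by
      gcongr
      exact min_le_left _ _
    linarith
  · set s := √T with hs
    have hs0 : 0 < s := Real.sqrt_pos.2 hT0
    have hss : s * s = T := Real.mul_self_sqrt hT0.le
    have hXs : X ≤ s := Real.le_sqrt_of_sq_le h.le
    have h1 : Real.log T ≤ 2 * s := by
      have h2 : Real.log s = Real.log T / 2 := Real.log_sqrt hT0.le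
      have h3 := Real.log_le_self hs0.le
      linarith
    have h2 : 2 / lam ≤ 4 / s := by
      rw [div_le_div_iff₀ hlam hs0]
      have h4 : X * lam = T * H := by rw [hX]; field_simp
      have h5 : s * s * (1 / 2) ≤ s * lam := by
        calc s * s * (1 / 2) ≤ T * H := by rw [hss]; gcongr
          _ = X * lam := h4.symm
          _ ≤ s * lam := by gcongr
      have h6 : s * (s * (1 / 2)) ≤ s * lam := by linarith
      have := le_of_mul_le_mul_left h6 hs0
      linarith
    have h3 : min 1 (2 / lam) * Real.log T ≤ 4 / s * (2 * s) :=
      mul_le_mul ((min_le_right _ _).trans h2) h1 hlT (by positivity)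
    have h4 : 4 / s * (2 * s) = 8 := by field_simp; norm_num
    linarith

lemma delay_eq {lam : ℝ} {T : ℕ} (hlam : 0 < lam) (hT : 2 ≤ T) (hγ : 0 < γ) :
    delay γ lam T = (Real.log T + Real.log (T * discountedHorizon γ T / lam)) /
      Real.log (1 / γ) := by
  have hH := hγ.trans_le (le_discountedHorizon hγ (show 1 ≤ T by omega))
  have hT0 : (0 : ℝ) < T := by positivity
  rw [delay, ← Real.log_mul (by positivity) (by positivity)]
  congr 2
  ring

/-- The cost of the delay, if there are `m` suboptimal arms. -/
lemma delay_cost_le {lam : ℝ} {T K m : ℕ} (hlam : 0 < lam) (hT : 2 ≤ T) (hγ : 0 < γ)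
    (hγ1 : γ < 1) (hX : 2 * lam ≤ T * discountedHorizon γ T) (hmK : m + 1 ≤ K) :
    (delay γ lam T + 1) * min 1 (2 / lam) * Real.log (m + 1) ≤ 3 * (m * Real.log T) + m +
      17 * (Real.log (T * discountedHorizon γ T / lam) * Real.log K / Real.log (1 / γ)) := by
  have hl2 := Real.log_two_gt_d9
  have hT2 : (2 : ℝ) ≤ T := by exact_mod_cast hT
  have hX2 : 2 ≤ T * discountedHorizon γ T / lam := by rwa [le_div_iff₀ hlam]
  set X := T * discountedHorizon γ T / lam with hXdef
  have hlX : 1 / 2 ≤ Real.log X :=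
    (by linarith : (1 : ℝ) / 2 ≤ Real.log 2).trans (Real.log_le_log (by norm_num) hX2)
  have hlT : 0 ≤ Real.log T := Real.log_nonneg (by linarith)
  have hJ : 0 < Real.log (1 / γ) := Real.log_pos (by rw [lt_div_iff₀ hγ]; linarith)
  rw [delay_eq hlam hT hγ]
  set J := Real.log (1 / γ) with hJdef
  set G := min 1 (2 / lam) with hG
  have hG0 : 0 ≤ G := le_min zero_le_one (by positivity)
  have hG1 : G ≤ 1 := min_le_left _ _
  set l := Real.log ((m : ℝ) + 1) with hl
  have hm0 : (0 : ℝ) ≤ m := Nat.cast_nonneg m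
  have hl0 : 0 ≤ l := Real.log_nonneg (by linarith)
  have hlm : l ≤ m := by
    have := Real.log_le_sub_one_of_pos (show (0 : ℝ) < m + 1 by positivity)
    linarith
  have hlK : l ≤ Real.log K := by
    refine Real.log_le_log (by positivity) ?_
    exact_mod_cast hmK
  have h1 : G * l ≤ m := (mul_le_of_le_one_left hl0 hG1).trans hlm
  have h2 : Real.log X / J * (G * l) ≤ Real.log X * Real.log K / J := by
    rw [mul_div_right_comm]
    have : G * l ≤ Real.log K := (mul_le_of_le_one_left hl0 hG1).trans hlK
    gcongr
  have h3 : Real.log T / J * (G * l) ≤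
      3 * (m * Real.log T) + 16 * (Real.log X * Real.log K / J) := by
    have hK0 : 0 ≤ Real.log K := hl0.trans hlK
    have hB : 0 ≤ Real.log X * Real.log K / J := by positivity
    -- For `γ ≤ 1/2` the delay is only `O(log T)` in this part, and is charged to the `m` suboptimal
    -- arms. For `γ > 1/2` the horizon satisfies `T_γ ≥ γ > 1/2`, as `min_mul_log_le` requires.
    rcases le_or_gt γ (1 / 2) with h | h
    · have hJ2 : 1 / 2 ≤ J := by
        have : Real.log 2 ≤ J :=
          Real.log_le_log (by norm_num) (by rw [le_div_iff₀ hγ]; linarith)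
        linarith
      have h4 : Real.log T / J ≤ 2 * Real.log T := by
        rw [div_le_iff₀ hJ]
        nlinarith
      have h5 : Real.log T / J * (G * l) ≤ 2 * Real.log T * m := by gcongr
      nlinarith [mul_nonneg hm0 hlT]
    · have hH := le_discountedHorizon hγ (show 1 ≤ T by omega)
      have h4 := min_mul_log_le hlam hT2 (by linarith) hXdef hX2
      have h5 : Real.log T / J * (G * l) = (G * Real.log T) * l / J := by ring
      have h6 : (G * Real.log T) * l / J ≤ (16 * Real.log X) * Real.log K / J := by gcongr
      have h7 : (16 * Real.log X) * Real.log K / J = 16 * (Real.log X * Real.log K / J) := by ring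
      nlinarith [mul_nonneg hm0 hlT]
  have h4 : ((Real.log T + Real.log X) / J + 1) * G * l =
      Real.log T / J * (G * l) + Real.log X / J * (G * l) + G * l := by ring
  rw [h4]
  linarith

end Arithmetic

/-! ### Assembling the bound -/

section Main

variable {K : ℕ} [NeZero K] {β : Fin K → ℝ} {E lam γ : ℝ} {c : ℝ → ℝ}
  (P : Kernel (Icc (0 : ℝ) E) I) [IsMarkovKernel P] {T : ℕ}

lemma exists_gap_eq (β : Fin K → ℝ) (E : ℝ) (c : ℝ → ℝ) :
    ∃ b, (∀ i, truthfulUtility E c (β i) ≤ truthfulUtility E c (β b)) ∧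
      ∀ i, gap E c β i = truthfulUtility E c (β b) - truthfulUtility E c (β i) := by
  obtain ⟨b, hb⟩ := Finite.exists_max fun i => truthfulUtility E c (β i)
  refine ⟨b, hb, fun i => ?_⟩
  unfold gap bestUtility
  rw [le_antisymm (ciSup_le hb) (le_ciSup (f := fun i => truthfulUtility E c (β i))
    (Finite.bddAbove_range _) b)]

/-- An optimal agent stays close to truthful effort under delayed elimination, and is truthful
if there is only one contract. -/
lemma abs_meanEffort_sub_le (hβ : ∀ i, β i ∈ Icc (0 : ℝ) 1) (hE : 0 ≤ E) (hE1 : E ≤ 1)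
    (hlam : 0 < lam) (hγ : 0 < γ) (hγ1 : γ < 1) (hc0 : c 0 = 0)
    (hmono : MonotoneOn c (Icc (0 : ℝ) E)) (hconv : StrongConvexOn (Icc (0 : ℝ) E) lam c)
    (hbr : ∀ i, ∃ a, IsBestResponse E c (β i) a)
    (hP : ∀ a : Icc (0 : ℝ) E, ∫ y, (y : ℝ) ∂(P a) = (a : ℝ)) (hT : 2 ≤ T) {δ : ℝ}
    (hX : 2 * lam ≤ T * discountedHorizon γ T) (S : Strategy K E)
    (hopt : IsOptimalStrategy β c P γ T (delayedElimination β T (delay γ lam T) δ) S)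
    {t : ℕ} (ht : t < T) :
    ∀ᵐ h ∂(historyLaw P (delayedElimination β T (delay γ lam T) δ) S t),
      |meanEffort (measurable_nextArm β T (delay γ lam T) δ) S t h -
        bestResponse E c (β (nextArm β T (delay γ lam T) δ t (publicPart h)))| ≤
      if K = 1 then 0 else √(2 * γ) / T := by
  set D := delay γ lam T with hD
  have hD0 : 0 ≤ D := delay_nonneg hγ hγ1 hlam hT hX
  have hbr' := fun i => isBestResponse_bestResponse (hbr i)
  set x : Fin K → Icc (0 : ℝ) E := fun i => ⟨bestResponse E c (β i), (hbr' i).1⟩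
  set v : Fin K → ℝ := fun i => β i * x i - c (x i)
  have hcm : Measurable (fun a : Icc (0 : ℝ) E => c a) :=
    Monotone.measurable fun a b hab => hmono a.2 b.2 hab
  have hcnn : ∀ a : Icc (0 : ℝ) E, 0 ≤ c a := fun a => cost_nonneg hE hc0 hmono a.2
  have hcE : ∀ a : Icc (0 : ℝ) E, |c a| ≤ c E := fun a => by
    rw [abs_of_nonneg (hcnn a)]
    exact hmono a.2 ⟨hE, le_rfl⟩ a.2.2
  have hβa : ∀ i, ∀ a : Icc (0 : ℝ) E, 0 ≤ β i * a ∧ β i * a ≤ 1 := fun i a =>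
    ⟨mul_nonneg (hβ i).1 a.2.1, mul_le_one₀ (hβ i).2 a.2.1 (a.2.2.trans hE1)⟩
  have hR : ∀ i, ∀ a : Icc (0 : ℝ) E, |β i * a - c a| ≤ 1 + c E := fun i a => by
    refine (abs_sub _ _).trans (add_le_add ?_ (hcE a))
    rw [abs_of_nonneg (hβa i a).1]
    exact (hβa i a).2
  have hv : ∀ i, ∀ a : Icc (0 : ℝ) E, β i * a - c a ≤ v i := fun i a => (hbr' i).2 a a.2
  have hv0 : ∀ i, 0 ≤ v i := fun i => by
    have := hv i ⟨0, le_rfl, hE⟩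
    simpa [hc0] using this
  have hv1 : ∀ i, v i ≤ 1 := fun i => by
    have h1 := (hβa i (x i)).2
    have h2 := hcnn (x i)
    change β i * x i - c (x i) ≤ 1
    linarith
  -- For a single contract `log K = 0` removes the delay term from the bound, so the effort error
  -- must then vanish exactly.
  set κ : ℝ := if K = 1 then 0 else γ * lam / (T : ℝ) ^ 2 with hκ
  have hloss : ∀ᵐ h ∂(historyLaw P (delayedElimination β T D δ) S t),
      v (nextArm β T D δ t (publicPart h)) -
        stageReward (measurable_nextArm β T D δ) S β c t h ≤ κ := by
    have hae : ∀ m : ℕ, t < m → (∀ t', t < t' → t' < T → t' < m → ∀ h h' : Fin t' → Obs K,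
        (∀ j : Fin t', (j : ℕ) < t → h j = h' j) →
          nextArm β T D δ t' h = nextArm β T D δ t' h') → _ := fun m =>
      ae_loss_le (measurable_nextArm β T D δ) P (M := delayedElimination β T D δ)
        (fun _ => rfl) S x hcm β hR (v := v) (fun _ => rfl) hv hP hcE hv0 hv1 hγ hopt ht
    -- With one contract nothing the agent does has influence: `m = T` is admissible and the
    -- discounted tail is empty.
    by_cases hK : K = 1
    · subst hK
      filter_upwards [hae T ht fun _ _ _ _ _ _ _ => Subsingleton.elim _ _] with h hh
      simpa [hκ] using hh
    -- By `nextArm_congr`, round `t` can affect only contracts at indices above `t + 2 + D`; `m` is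
    -- the first such index.
    · have hfloor := Nat.lt_floor_add_one ((t : ℝ) + 2 + D)
      have htm : t < ⌊(t : ℝ) + 2 + D⌋₊ + 1 := by
        have : (t : ℝ) < (⌊(t : ℝ) + 2 + D⌋₊ + 1 : ℕ) := by
          push_cast
          linarith
        exact_mod_cast this
      have hinf : ∀ t', t < t' → t' < T → t' < ⌊(t : ℝ) + 2 + D⌋₊ + 1 →
          ∀ h h' : Fin t' → Obs K, (∀ j : Fin t', (j : ℕ) < t → h j = h' j) →
          nextArm β T D δ t' h = nextArm β T D δ t' h' := by
        intro t' _ _ ht' h h' hh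
        refine nextArm_congr β T D δ fun j hj => hh j ?_
        have h1 : (t' : ℝ) ≤ (t : ℝ) + 2 + D :=
          (Nat.le_floor_iff (by positivity)).1 (Nat.lt_succ_iff.1 ht')
        have h2 : (j : ℝ) < t := by linarith
        exact_mod_cast h2
      filter_upwards [hae (⌊(t : ℝ) + 2 + D⌋₊ + 1) htm hinf] with h hh
      refine hh.trans ?_
      rw [hκ, if_neg hK]
      refine influence_le hγ hγ1 hlam hT ?_
      push_cast
      exact hfloor.le
  filter_upwards [hloss] with h hh
  have h1 := lam_mul_sq_meanEffort_sub_le (measurable_nextArm β T D δ) S hcm hR hlam (v := v)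
    (x := fun i => (x i : ℝ)) (fun i a => (hbr' i).add_sq_le hconv a.2) t h
  have h2 := h1.trans hh
  change lam / 2 * (meanEffort _ S t h - bestResponse E c (β (nextArm β T D δ t (publicPart h))))
    ^ 2 ≤ κ at h2
  have hT0 : (0 : ℝ) < T := by positivity
  by_cases hK : K = 1
  · rw [if_pos hK]
    rw [hκ, if_pos hK] at h2
    have h3 : (meanEffort (measurable_nextArm β T D δ) S t h -
        bestResponse E c (β (nextArm β T D δ t (publicPart h)))) ^ 2 ≤ 0 := by
      by_contra! h4
      have : 0 < lam / 2 * (meanEffort (measurable_nextArm β T D δ) S t h -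
        bestResponse E c (β (nextArm β T D δ t (publicPart h)))) ^ 2 := by positivity
      linarith
    rw [pow_eq_zero_iff (two_ne_zero) |>.1 (le_antisymm h3 (sq_nonneg _))]
    simp
  · rw [if_neg hK]
    rw [hκ, if_neg hK] at h2
    refine abs_le_of_sq_le_sq ?_ (by positivity)
    rw [div_pow, Real.sq_sqrt (by positivity), le_div_iff₀ (by positivity)]
    rw [le_div_iff₀ (by positivity)] at h2
    nlinarith

/-- The expected sum of the gaps under delayed elimination. -/
lemma integral_sum_gap_le (hβ : ∀ i, β i ∈ Icc (0 : ℝ) 1) (hlam : 0 < lam) (hγ : 0 < γ)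
    (hγ1 : γ < 1) (hP : ∀ a : Icc (0 : ℝ) E, ∫ y, (y : ℝ) ∂(P a) = (a : ℝ)) (hT : 2 ≤ T)
    (hX : 2 * lam ≤ T * discountedHorizon γ T) (S : Strategy K E)
    (hgap : ∀ i, gap E c β i ≤ min 1 (2 / lam)) {ε : ℝ} (hε : ε ≤ 3 / 2 / T)
    (hx : ∀ t < T, ∀ᵐ h ∂(historyLaw P
        (delayedElimination β T (delay γ lam T) (1 / (T : ℝ))) S t),
      |meanEffort (measurable_nextArm β T (delay γ lam T) (1 / (T : ℝ))) S t h -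
        bestResponse E c (β (nextArm β T (delay γ lam T) (1 / (T : ℝ)) t (publicPart h)))| ≤ ε) :
    ∫ h, ∑ j : Fin T, gap E c β (h j).1.1
        ∂(historyLaw P (delayedElimination β T (delay γ lam T) (1 / (T : ℝ))) S T) ≤
      (150 + 8 * Real.exp 3) *
          (∑ i with 0 < gap E c β i, Real.log T / gap E c β i) +
        17 * (Real.log (T * discountedHorizon γ T / lam) * Real.log K / Real.log (1 / γ)) := by
  set D := delay γ lam T with hD
  set δ : ℝ := 1 / (T : ℝ) with hδ
  set M := delayedElimination β T D δ with hMdef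
  have hD0 : 0 ≤ D := delay_nonneg hγ hγ1 hlam hT hX
  have hT0 : (0 : ℝ) < T := by positivity
  have hT2 : (2 : ℝ) ≤ T := by exact_mod_cast hT
  have hδ0 : 0 ≤ δ := by positivity
  have hl2 := Real.log_two_gt_d9
  have hlT : 1 / 2 ≤ Real.log T :=
    (by linarith : (1 : ℝ) / 2 ≤ Real.log 2).trans (Real.log_le_log (by norm_num) hT2)
  obtain ⟨b, hb, hgapb⟩ := exists_gap_eq β E c
  have hgap0 : ∀ i, 0 ≤ gap E c β i := fun i => by rw [hgapb]; linarith [hb i]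
  have hgap1 : ∀ i, gap E c β i ≤ 1 := fun i => (hgap i).trans (min_le_left _ _)
  set sub := Finset.univ.filter fun i => 0 < gap E c β i with hsub
  set Q := ∑ i ∈ sub, Real.log T / gap E c β i with hQ
  have hlogle : ∀ i ∈ sub, Real.log T ≤ Real.log T / gap E c β i := by
    intro i hi
    have hpos : 0 < gap E c β i := by simpa [hsub] using hi
    rw [le_div_iff₀ hpos]
    exact mul_le_of_le_one_right (by linarith) (hgap1 i)
  have hmQ : sub.card * Real.log T ≤ Q := by
    have := Finset.sum_le_sum hlogle
    simpa using this
  have hQ0 : 0 ≤ Q := le_trans (by positivity) hmQ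
  have hcard0 : (0 : ℝ) ≤ sub.card := Nat.cast_nonneg _
  have hmQ' : (sub.card : ℝ) ≤ 2 * Q := by nlinarith
  have hmK : sub.card + 1 ≤ K := by
    have hbn : b ∉ sub := by simp [hsub, hgapb]
    rw [← Finset.card_insert_of_notMem hbn]
    exact (Finset.card_le_univ _).trans (Fintype.card_fin K).le
  have hK1 : (1 : ℝ) ≤ K := by
    have : 1 ≤ K := by omega
    exact_mod_cast this
  have hX2 : 2 ≤ T * discountedHorizon γ T / lam := by rwa [le_div_iff₀ hlam]
  have hB0 : 0 ≤ Real.log (T * discountedHorizon γ T / lam) * Real.log K / Real.log (1 / γ) := by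
    refine div_nonneg (mul_nonneg (Real.log_nonneg (by linarith)) (Real.log_nonneg hK1))
      (Real.log_nonneg ?_)
    rw [le_div_iff₀ hγ]
    linarith
  set R := Real.log (T * discountedHorizon γ T / lam) * Real.log K / Real.log (1 / γ) with hR
  have hint : Integrable (fun h : Fin T → Round K E => ∑ j : Fin T, gap E c β (h j).1.1)
      (historyLaw P M S T) := by
    refine integrable_finsetSum _ fun j _ => ?_
    refine Integrable.of_bound ((measurable_of_finite (gap E c β)).comp
      (by fun_prop)).aestronglyMeasurable 1 (Filter.Eventually.of_forall fun h => ?_)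
    rw [Real.norm_eq_abs, abs_of_nonneg (hgap0 _)]
    exact hgap1 _
  have hobs : ∀ h : Fin T → Round K E, ∑ j : Fin T, gap E c β (h j).1.1 =
      ∑ j ∈ Finset.range T, gap E c β (observations h j).1 := by
    intro h
    rw [Finset.sum_range]
    refine Finset.sum_congr rfl fun j _ => ?_
    simp [observations]
  have hfollow : ∀ᵐ h ∂(historyLaw P M S T), FollowsElimination β T D δ (observations h) := by
    filter_upwards [ae_contract_eq (measurable_nextArm β T D δ) P (M := M) (fun _ => rfl) S
      (T := T)] with h hh
    intro t ht
    rw [initialSegment_observations ht.le, ← hh ⟨t, ht⟩]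
    simp [observations, ht]
  have hexp := Real.exp_pos 3
  -- Without suboptimal arms the gaps contribute nothing. With one, the gap sum `Q` is at least
  -- `1/2` and absorbs additive constants.
  by_cases hm : sub = ∅
  · have hzero : ∀ i, gap E c β i = 0 := fun i => by
      refine le_antisymm (not_lt.1 fun hi => ?_) (hgap0 i)
      have : i ∈ sub := by simp [hsub, hi]
      simp [hm] at this
    simp only [hzero, Finset.sum_const_zero, integral_zero]
    positivity
  have hcard1 : (1 : ℝ) ≤ sub.card := by
    exact_mod_cast Finset.card_pos.2 (Finset.nonempty_iff_ne_empty.2 hm)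
  have hsumgap : ∑ i ∈ sub, gap E c β i ≤ sub.card := by
    have := Finset.sum_le_sum fun i (_ : i ∈ sub) => hgap1 i
    simpa using this
  -- For `T ≤ K` the union bound over arms is too weak, but all rounds lie in the first pass and no
  -- concentration is needed.
  rcases le_or_gt T K with hTK | hKT
  · have h1 : ∫ h, ∑ j : Fin T, gap E c β (h j).1.1 ∂(historyLaw P M S T) ≤
        ∫ _h, ∑ i ∈ sub, gap E c β i ∂(historyLaw P M S T) := by
      refine integral_mono_ae hint (integrable_const _) ?_
      filter_upwards [hfollow] with h hh
      simp only [hobs h]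
      exact sum_gap_le_of_le_card hδ0 hh hTK hgap0
    rw [integral_const, probReal_univ, one_smul] at h1
    nlinarith [mul_nonneg hexp.le hQ0]
  · have hbad := measure_not_isConcentrated_le (measurable_nextArm β T D δ) P (M := M)
      (fun _ => rfl) S hP (x := fun i => bestResponse E c (β i)) hx hT hKT.le hε
    set A := (∑ i ∈ sub, (128 * Real.log T / gap E c β i + 4 * gap E c β i)) +
      (D + 1) * min 1 (2 / lam) * Real.log (sub.card + 1) with hA
    have hG0 : 0 ≤ min 1 (2 / lam) := le_min zero_le_one (by positivity)
    have hA0 : 0 ≤ A := by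
      refine add_nonneg (Finset.sum_nonneg fun i hi => ?_) (mul_nonneg (by positivity)
        (Real.log_nonneg (by linarith)))
      have hpos : 0 < gap E c β i := by simpa [hsub] using hi
      positivity
    -- Off the concentration event the sum of gaps is at most `T`, which the failure probability `4
    -- exp 3 / T` reduces to a constant.
    have h1 := integral_le_add_mul_measure hint (A := A) (B := T) hA0 hT0.le
      (by positivity) hbad ?_ ?_
    · have h2 : (T : ℝ) * (4 * Real.exp 3 / T) = 4 * Real.exp 3 := by field_simp
      rw [h2] at h1
      have h3 : ∑ i ∈ sub, (128 * Real.log T / gap E c β i + 4 * gap E c β i) =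
          128 * Q + 4 * ∑ i ∈ sub, gap E c β i := by
        rw [Finset.sum_add_distrib, hQ, Finset.mul_sum, Finset.mul_sum]
        congr 1
        exact Finset.sum_congr rfl fun i _ => by ring
      have h4 := delay_cost_le hlam hT hγ hγ1 hX hmK
      rw [← hD, ← hR] at h4
      rw [hA, h3] at h1
      have h5 : 4 * Real.exp 3 ≤ 8 * Real.exp 3 * Q := by nlinarith
      linarith
    · intro h
      have := Finset.sum_le_sum fun j (_ : j ∈ (Finset.univ : Finset (Fin T))) =>
        hgap1 (h j).1.1
      simpa using this
    · filter_upwards [hfollow] with h hh hmem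
      have hc : IsConcentrated T δ (fun i => bestResponse E c (β i)) (observations h) := by
        exact not_not.1 hmem
      rw [hobs h]
      exact sum_gap_le hβ hT hD0 hδ0 le_rfl hh hc hb hgapb hgap

end Main

end NonMyopic

theorem mainTheorem5 :
    ∃ C : ℝ, 0 < C ∧
      ∀ (K : ℕ) [NeZero K] (β : Fin K → ℝ) (_ : ∀ i, β i ∈ Icc (0 : ℝ) 1)
        (E lam γ : ℝ) (_ : 0 ≤ E) (_ : 0 < lam) (_ : 0 < γ) (_ : γ < 1)
        (c : ℝ → ℝ) (_ : c 0 = 0) (_ : MonotoneOn c (Icc (0 : ℝ) E))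
        (_ : StrongConvexOn (Icc (0 : ℝ) E) lam c)
        (_ : ∀ i, ∃ a, NonMyopic.IsBestResponse E c (β i) a)
        (P : Kernel (Icc (0 : ℝ) E) I) [IsMarkovKernel P]
        (_ : ∀ a : Icc (0 : ℝ) E, ∫ y, (y : ℝ) ∂(P a) = (a : ℝ))
        (T : ℕ) (_ : 2 ≤ T) (_ : 2 * lam ≤ (T : ℝ) * NonMyopic.discountedHorizon γ T)
        (S : NonMyopic.Strategy K E)
        (_ : NonMyopic.IsOptimalStrategy β c P γ T
          (NonMyopic.delayedElimination β T (NonMyopic.delay γ lam T) (1 / (T : ℝ))) S),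
        NonMyopic.strategicRegret β c P T
            (NonMyopic.delayedElimination β T (NonMyopic.delay γ lam T) (1 / (T : ℝ))) S ≤
          C * ((∑ i with 0 < NonMyopic.gap E c β i, Real.log T / NonMyopic.gap E c β i) +
            Real.log ((T : ℝ) * NonMyopic.discountedHorizon γ T / lam) * Real.log K /
              Real.log (1 / γ)) := by
  refine ⟨150 + 8 * Real.exp 3, by positivity, ?_⟩
  intro K _ β hβ E lam γ hE hlam hγ hγ1 c hc0 hmono hconv hbr P _ hP T hT hX S hopt
  have hT0 : (0 : ℝ) < T := by positivity
  -- The effort `E` is the mean of an output in `[0, 1]`.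
  have hE1 : E ≤ 1 := by
    have h1 : ∫ y, (y : ℝ) ∂(P ⟨E, hE, le_rfl⟩) = E := hP ⟨E, hE, le_rfl⟩
    have h2 := integral_mono (NonMyopic.integrable_unitInterval (P ⟨E, hE, le_rfl⟩))
      (integrable_const (1 : ℝ)) fun y => y.2.2
    simp only [integral_const, probReal_univ, one_smul] at h2
    linarith
  have hbr' := fun i => NonMyopic.isBestResponse_bestResponse (hbr i)
  have hx01 : ∀ i, NonMyopic.bestResponse E c (β i) ∈ Icc (0 : ℝ) 1 := fun i =>
    ⟨(hbr' i).1.1, (hbr' i).1.2.trans hE1⟩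
  have hu0 : ∀ i, 0 ≤ NonMyopic.truthfulUtility E c (β i) := fun i =>
    mul_nonneg (by linarith [(hβ i).2]) (hx01 i).1
  have hu : ∀ i, NonMyopic.truthfulUtility E c (β i) ≤ NonMyopic.bestResponse E c (β i) :=
    fun i => mul_le_of_le_one_left (hx01 i).1 (by linarith [(hβ i).1])
  obtain ⟨b, hb, hgapb⟩ := NonMyopic.exists_gap_eq β E c
  have hgap : ∀ i, NonMyopic.gap E c β i ≤ min 1 (2 / lam) := fun i => by
    rw [hgapb]
    refine le_min ?_ ?_
    · linarith [hu b, hu0 i, (hx01 b).2]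
    · linarith [hu b, hu0 i, (hbr' b).le_two_div hE hc0 hmono hconv hlam (hβ b).2]
  have hgap0 : ∀ i, 0 ≤ NonMyopic.gap E c β i := fun i => by rw [hgapb]; linarith [hb i]
  set δ : ℝ := 1 / (T : ℝ)
  have hx := fun t (ht : t < T) => NonMyopic.abs_meanEffort_sub_le P hβ hE hE1 hlam hγ hγ1 hc0
    hmono hconv hbr hP hT hX S hopt ht
  set ε : ℝ := if K = 1 then 0 else √(2 * γ) / T with hεdef
  have hε : ε ≤ 3 / 2 / T := by
    rw [hεdef]
    split_ifs
    · positivity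
    · refine div_le_div_of_nonneg_right (Real.sqrt_le_iff.2 ⟨by norm_num, by linarith⟩) hT0.le
  have hreg := NonMyopic.strategicRegret_le (NonMyopic.measurable_nextArm β T _ δ) P
    (fun _ => rfl) S hβ hP hx01 hx
  have hsum := NonMyopic.integral_sum_gap_le P hβ hlam hγ hγ1 hP hT hX S hgap hε hx
  have hX2 : 2 ≤ T * NonMyopic.discountedHorizon γ T / lam := by rwa [le_div_iff₀ hlam]
  have hl2 := Real.log_two_gt_d9
  have hlX : 1 / 2 ≤ Real.log (T * NonMyopic.discountedHorizon γ T / lam) :=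
    (by linarith : (1 : ℝ) / 2 ≤ Real.log 2).trans (Real.log_le_log (by norm_num) hX2)
  have hJ : 0 < Real.log (1 / γ) := Real.log_pos (by rw [lt_div_iff₀ hγ]; linarith)
  have hK0 : 0 ≤ Real.log K := Real.log_natCast_nonneg K
  have hB0 : 0 ≤ Real.log (T * NonMyopic.discountedHorizon γ T / lam) * Real.log K /
      Real.log (1 / γ) := by positivity
  -- For `K ≥ 2` both logarithms in the numerator are at least `1/2`, while `√2 √γ log (1/γ) ≤ 3`;
  -- hence the factor 12.
  have hdev : T * ε ≤ 12 * (Real.log (T * NonMyopic.discountedHorizon γ T / lam) * Real.log K /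
      Real.log (1 / γ)) := by
    rw [hεdef]
    split_ifs with hK
    · rw [mul_zero]
      positivity
    · have hK2 : (2 : ℝ) ≤ K := by
        have : K ≠ 0 := NeZero.ne K
        have : 2 ≤ K := by omega
        exact_mod_cast this
      have hlK : 1 / 2 ≤ Real.log K :=
        (by linarith : (1 : ℝ) / 2 ≤ Real.log 2).trans (Real.log_le_log (by norm_num) hK2)
      have h1 : T * (√(2 * γ) / T) = √2 * √γ := by
        rw [Real.sqrt_mul (by norm_num)]
        field_simp
      have h2 := NonMyopic.sqrt_mul_log_inv_le hγ
      have h3 : √2 ≤ 3 / 2 := Real.sqrt_le_iff.2 ⟨by norm_num, by norm_num⟩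
      rw [h1, mul_div_assoc', le_div_iff₀ hJ]
      have h4 : √2 * √γ * Real.log (1 / γ) ≤ 3 / 2 * 2 := by
        rw [mul_assoc]
        exact mul_le_mul h3 h2 (by positivity) (by norm_num)
      nlinarith [mul_le_mul hlX hlK (by norm_num) (by linarith)]
  nlinarith [mul_nonneg (Real.exp_pos 3).le hB0]
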